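/- Let $p$ be a prime and $n\ge 0$ an integer. For an algebraically closed field $\mathbb K$ with a nontrivial real valuation $v$, let $\Delta_v\subseteq\mathbb R^{n+1}$ (the tropical discriminant of degree-$n$ polynomials) be the closure of the set of vectors $(v(A_0),\dots,v(A_n))$, where $F=\sum_{i=0}^n A_iX^i$ runs over the polynomials with all $A_i\in\mathbb K^*$ that have a double root $B\in\mathbb K^*$, i.e. $F(B)=F'(B)=0$. A pair $(a,b)\in\mathbb R^{n+1}\times\mathbb R$ in the closure of the set of the corresponding pairs $\big((v(A_0),\dots,v(A_n)),v(B)\big)$ is called a tropical polynomial $a$ with double root $b$ (with respect to $v$). Write $\Delta_p$ for this discriminant when $\operatorname{char}\mathbb K=0$ and $v(p)=1$ (the $p$-adic case), and $\Delta_{p,n}$ for it when $\operatorname{char}\mathbb K=p$. For $a\in\mathbb R^{n+1}$ and $b\in\mathbb R$ let $L_0(a,b)$ be the set of indices $i$ at which $\min_i(a_i+ib)$ is attained. For $M>0$ let $R_M\subseteq\mathbb R^{n+1}$ be the region $L_0\ll L_1$ with gap $M$: the set of $a$ that have a double root $b$ such that $a_j+jb\ge a_i+ib+M$ for all $i\in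 L_0(a,b)$ and $j\notin L_0(a,b)$. (There are two such regions, according to whether double roots are taken $p$-adically or in characteristic $p$; the statement holds for each.) For $i,j,k\in\{0,\dots,n\}$ with pairwise different residues modulo $p$, the cone of type I with label $\{i,j,k\}$ is $\{a\in\mathbb R^{n+1} : \{i,j,k\}\subseteq L_0(a,b)\text{ for some }b\in\mathbb R\}$. A cell of $X\subseteq\mathbb R^{n+1}$ is a nonempty $n$-dimensional convex subset of $X$, and a maximal cell of $X$ is an inclusion-maximal one. There are $\epsilon_0>0$ and $M_0>0$, depending only on $p$ and $n$, such that for all valued fields as above: 1. $\Delta_p\cap B(0,\epsilon)=\Delta_{p,n}\cap B(0,\epsilon)$ for all $0<\epsilon\le\epsilon_0$, where $B(0,\epsilon)$ is the open ball in the maximum norm. 2. For all $M\ge M_0$, the sets that are maximal cells of both $\Delta_p$ and $\Delta_{p,n}$ and that meet $R_M$ in full dimension $n$ (that is, $C\cap R_M$ contains a nonempty $n$-dimensional convex set) are precisely the cones of type I. Moreover, every cell of $\Delta_p\cap\Delta_{p,n}\cap R_M$ is contained in a cone of type I. -/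

import Mathlib

open Polynomial

/-- The pairs `(a, b)`, with `a = (v A₀, …, v Aₙ)` and `b = v B`, where `F = A₀ + A₁ X + ⋯ + Aₙ Xⁿ`
has only nonzero coefficients and `B ≠ 0` is a singular point (a double root) of `F`.
The condition `v A = (a : WithTop ℝ)` forces `A ≠ 0`. -/
def liftedPairs {K : Type*} [Field K] (v : AddValuation K (WithTop ℝ)) (n : ℕ) :
    Set ((Fin (n + 1) → ℝ) × ℝ) :=
  {q | ∃ (F : K[X]) (B : K), F.natDegree = n ∧
      (∀ i : Fin (n + 1), v (F.coeff i) = ((q.1 i : ℝ) : WithTop ℝ)) ∧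
      v B = ((q.2 : ℝ) : WithTop ℝ) ∧
      F.eval B = 0 ∧ F.derivative.eval B = 0}

/-- The pairs `(f, b)` of a tropical polynomial `f` of degree `n` and a tropical double root `b`
of `f`, with respect to the valuation `v` (real points are obtained by taking the closure). -/
def doubleRootPairs {K : Type*} [Field K] (v : AddValuation K (WithTop ℝ)) (n : ℕ) :
    Set ((Fin (n + 1) → ℝ) × ℝ) :=
  closure (liftedPairs v n)

/-- The tropical discriminant of degree `n` polynomials: the tropicalization (closure of the
coordinatewise valuations) of the set of polynomials with a double root in `Kˣ`. -/
def tropDiscriminant {K : Type*} [Field K] (v : AddValuation K (WithTop ℝ)) (n : ℕ) :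
    Set (Fin (n + 1) → ℝ) :=
  closure (Prod.fst '' liftedPairs v n)

/-- The value at `b` of the monomial `aᵢ xⁱ` of the tropical polynomial `a`. -/
def monomialValue {n : ℕ} (a : Fin (n + 1) → ℝ) (b : ℝ) (i : Fin (n + 1)) : ℝ :=
  a i + (i : ℕ) * b

/-- `L₀`: the monomials of `a` at which the minimum is attained at the point `b`. -/
def minMonomials {n : ℕ} (a : Fin (n + 1) → ℝ) (b : ℝ) : Set (Fin (n + 1)) :=
  {i | ∀ j, monomialValue a b i ≤ monomialValue a b j}

/-- The region `L₀ ≪ L₁` with gap `M`: the tropical polynomials with a double root `b` at which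
every monomial that is not minimal exceeds the minimal ones by at least `M`. -/
def gapRegion {n : ℕ} (S : Set ((Fin (n + 1) → ℝ) × ℝ)) (M : ℝ) : Set (Fin (n + 1) → ℝ) :=
  {a | ∃ b : ℝ, (a, b) ∈ S ∧ ∀ i ∈ minMonomials a b, ∀ j ∉ minMonomials a b,
      monomialValue a b i + M ≤ monomialValue a b j}

/-- The cone of the tropical polynomials of degree `n` whose minimum at some point `b`
is attained at `i`, `j`, `k`. -/
def tripleCone {n : ℕ} (i j k : Fin (n + 1)) : Set (Fin (n + 1) → ℝ) :=
  {a | ∃ b : ℝ, i ∈ minMonomials a b ∧ j ∈ minMonomials a b ∧ k ∈ minMonomials a b}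

/-- The type I cones: `i`, `j`, `k` have three different residues modulo `p`. -/
def typeICones (p n : ℕ) : Set (Set (Fin (n + 1) → ℝ)) :=
  {C | ∃ i j k : Fin (n + 1), ¬ (i : ℕ) ≡ j [MOD p] ∧ ¬ (i : ℕ) ≡ k [MOD p] ∧
      ¬ (j : ℕ) ≡ k [MOD p] ∧ C = tripleCone i j k}

/-- A nonempty convex subset of `ℝⁿ⁺¹` of dimension `n` (the dimension of the discriminants). -/
def IsTopCell {n : ℕ} (P : Set (Fin (n + 1) → ℝ)) : Prop :=
  P.Nonempty ∧ Convex ℝ P ∧ Module.finrank ℝ (vectorSpan ℝ P) = n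

/-- A maximal cell of `X`: an inclusion-maximal one among the `n`-dimensional convex subsets. -/
def IsMaximalCell {n : ℕ} (X C : Set (Fin (n + 1) → ℝ)) : Prop :=
  Maximal (fun P => IsTopCell P ∧ P ⊆ X) C

/-! Put `c i = A i * B ^ i`. A double root `B` means `∑ c i = 0` and `∑ i * c i = 0`, a linear
system whose consequences `∑ (i - j) * c i = 0`, one for each `j`, are called circuits below. Over a
dense value group, the closure of the liftable pairs is exactly the set where every circuit attains
its minimal valuation twice (`doubleRootPairs_eq_circuitLocus`). The two settings differ only in the
coefficients: for distinct `i ≡ j` mod `p`, the number `i - j` has valuation between `1` and `n` in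
the `p`-adic case and vanishes in characteristic `p`; all incongruent differences have valuation
`0`.

Near the origin, all monomial values at a double root are less than `1` apart, so the congruent
terms never reach the minimum of a circuit and the loci agree (`mem_padicLocus_iff_mem_charLocus`).

For the cells, an `n`-dimensional convex set `P` determines a hyperplane. At a point of `P` without
accidental coincidences, two independent ties at the same `b` give a linear form defining this
hyperplane, and its support is exactly the set of monomials in the ties (`IsTopCell.ties_eq`). Hence
all double roots of that point, in both settings, tie the same monomials. In the gap region this
forces three minimal monomials, and the circuits force them to be incongruent, so `P` lies in a type
I cone (`exists_tripleCone_superset`). Conversely, a cell extending a type I cone stays in the same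
hyperplane, and there the circuits force the triple to be minimal, so the cone is maximal. -/

/-! ### Circuit equations of a double root -/

/-- The tropical vanishing locus of the linear forms `∑ᵢ (i - j) Aᵢ Bⁱ`, where `E i j` says that
`i - j ≠ 0` and `D i j` is the valuation of `i - j`. -/
def circuitLocus {n : ℕ} (E : Fin (n + 1) → Fin (n + 1) → Prop)
    (D : Fin (n + 1) → Fin (n + 1) → ℕ) : Set ((Fin (n + 1) → ℝ) × ℝ) :=
  {q | ∀ j, ∃ x y, x ≠ y ∧ E x j ∧ E y j ∧ ∀ i, E i j →
    monomialValue q.1 q.2 x + D x j ≤ monomialValue q.1 q.2 i + D i j ∧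
    monomialValue q.1 q.2 y + D y j ≤ monomialValue q.1 q.2 i + D i j}

theorem continuous_monomialValue {n : ℕ} (i : Fin (n + 1)) :
    Continuous fun q : (Fin (n + 1) → ℝ) × ℝ => monomialValue q.1 q.2 i := by
  unfold monomialValue
  fun_prop

theorem isClosed_circuitLocus {n : ℕ} (E : Fin (n + 1) → Fin (n + 1) → Prop)
    (D : Fin (n + 1) → Fin (n + 1) → ℕ) : IsClosed (circuitLocus E D) := by
  unfold circuitLocus
  simp only [Set.ofPred_forall, Set.ofPred_exists, Set.ofPred_and]
  refine isClosed_iInter fun j => isClosed_iUnion_of_finite fun x =>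
    isClosed_iUnion_of_finite fun y => (isClosed_iInter fun _ => isClosed_const).inter <| isClosed_const.inter <|
      isClosed_const.inter <| isClosed_iInter fun i => isClosed_iInter fun _ => ?_
  have h := fun i => continuous_monomialValue (n := n) i
  exact (isClosed_le (by fun_prop) (by fun_prop)).inter (isClosed_le (by fun_prop) (by fun_prop))

theorem natCast_sub_ne_zero {n : ℕ} {x y : Fin n} (h : x ≠ y) : ((x : ℕ) : ℝ) - (y : ℕ) ≠ 0 := by
  rw [sub_ne_zero]
  exact_mod_cast fun e => h (Fin.ext e)

/-- The tie in the circuit of `0` expresses `b` as a continuous function of `a`, with finitely many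
choices of `x`, `y`. The projection is thus a finite union of preimages of a closed set. -/
theorem isClosed_fst_image_circuitLocus {n : ℕ} (E : Fin (n + 1) → Fin (n + 1) → Prop)
    (D : Fin (n + 1) → Fin (n + 1) → ℕ) : IsClosed (Prod.fst '' circuitLocus E D) := by
  have key : Prod.fst '' circuitLocus E D = ⋃ x : Fin (n + 1), ⋃ y : Fin (n + 1),
      {a : Fin (n + 1) → ℝ | (a, (a x - a y + ((D x 0 : ℝ) - D y 0)) / ((y : ℕ) - (x : ℕ)))
        ∈ circuitLocus E D} := by
    ext a
    simp only [Set.mem_image, Prod.exists, exists_and_right, exists_eq_right, Set.mem_iUnion,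
      Set.mem_ofPred_eq]
    constructor
    · rintro ⟨b, hb⟩
      obtain ⟨x, y, hxy, hx, hy, h⟩ := hb 0
      have h1 := (h x hx).2
      have h2 := (h y hy).1
      refine ⟨x, y, ?_⟩
      have : (a x - a y + ((D x 0 : ℝ) - D y 0)) / ((y : ℕ) - (x : ℕ)) = b := by
        rw [div_eq_iff (natCast_sub_ne_zero hxy.symm)]
        simp only [monomialValue] at h1 h2
        linarith
      rwa [this]
    · rintro ⟨x, y, h⟩
      exact ⟨_, h⟩
  rw [key]
  refine isClosed_iUnion_of_finite fun x => isClosed_iUnion_of_finite fun y => ?_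
  exact (isClosed_circuitLocus E D).preimage (by fun_prop)

/-! ### Generic points of a cell and ties between monomials -/

/-- Points of a convex set outside the zero sets of those of finitely many affine functions that
do not vanish identically on it are dense. -/
theorem Convex.subset_closure_generic {V ι : Type*} [AddCommGroup V] [Module ℝ V]
    [TopologicalSpace V] [IsTopologicalAddGroup V] [ContinuousSMul ℝ V] {P : Set V}
    (hP : Convex ℝ P) (h : ι → V → ℝ) (hc : ∀ i, Continuous (h i))
    (ha : ∀ i a q t, h i (a + t • (q - a)) = h i a + t * (h i q - h i a)) (s : Finset ι) :
    P ⊆ closure {a | a ∈ P ∧ ∀ i ∈ s, h i a = 0 → ∀ q ∈ P, h i q = 0} := by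
  classical
  induction s using Finset.induction_on with
  | empty => simpa using subset_closure
  | insert i s _ ih =>
    by_cases hi : ∀ q ∈ P, h i q = 0
    · refine ih.trans (closure_mono ?_)
      rintro a ⟨haP, hs⟩
      refine ⟨haP, fun k hk h0 => ?_⟩
      rcases Finset.mem_insert.1 hk with rfl | hk
      · exact hi
      · exact hs k hk h0
    · push Not at hi
      obtain ⟨q, hq, hiq⟩ := hi
      refine ih.trans (closure_minimal ?_ isClosed_closure)
      rintro a ⟨haP, hs⟩
      by_cases h0 : h i a = 0
      -- A small move towards `q` makes `h i` equal to `t * h i q ≠ 0`, while the functions that are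
      -- nonzero at `a` stay nonzero.
      · have hpath : Continuous fun t : ℝ => a + t • (q - a) := by fun_prop
        have hlim : Filter.Tendsto (fun t : ℝ => a + t • (q - a)) (nhdsWithin 0 (Set.Ioi 0))
            (nhds a) := by
          have := (hpath.tendsto 0).mono_left (nhdsWithin_le_nhds (s := Set.Ioi (0 : ℝ)))
          simpa using this
        refine mem_closure_of_tendsto hlim ?_
        have hev : ∀ k ∈ s, ∀ᶠ t : ℝ in nhdsWithin 0 (Set.Ioi 0),
            h k (a + t • (q - a)) = 0 → ∀ q ∈ P, h k q = 0 := by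
          intro k hk
          by_cases hka : h k a = 0
          · exact Filter.Eventually.of_forall fun _ _ => hs k hk hka
          · have := (((hc k).tendsto a).comp hlim).eventually_ne hka
            filter_upwards [this] with t ht h0
            exact absurd h0 ht
        have hmem : ∀ᶠ t : ℝ in nhdsWithin 0 (Set.Ioi 0), t ∈ Set.Ioo (0 : ℝ) 1 :=
          Ioo_mem_nhdsGT one_pos
        filter_upwards [(Filter.eventually_all_finset s).2 hev, hmem] with t ht ht1
        refine ⟨hP.add_smul_sub_mem haP hq ⟨ht1.1.le, ht1.2.le⟩, fun k hk h1 => ?_⟩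
        rcases Finset.mem_insert.1 hk with rfl | hk
        · rw [ha, h0, zero_add, sub_zero] at h1
          exact absurd h1 (mul_ne_zero ht1.1.ne' hiq)
        · exact ht k hk h1
      · refine subset_closure ⟨haP, fun k hk h1 => ?_⟩
        rcases Finset.mem_insert.1 hk with rfl | hk
        · exact absurd h1 h0
        · exact hs k hk h1

/-- It vanishes when the points where the monomials `x`, `y` differ by `c` and where `z`, `t`
differ by `c'` coincide. -/
def slopeDefect {n : ℕ} (x y z t : Fin (n + 1)) (c c' : ℝ) (a : Fin (n + 1) → ℝ) : ℝ :=
  ((t : ℕ) - (z : ℕ)) * (a x - a y + c) - ((y : ℕ) - (x : ℕ)) * (a z - a t + c')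

/-- The linear part of `slopeDefect`. -/
def slopeForm {n : ℕ} (x y z t : Fin (n + 1)) : (Fin (n + 1) → ℝ) →ₗ[ℝ] ℝ :=
  let e (i : Fin (n + 1)) : (Fin (n + 1) → ℝ) →ₗ[ℝ] ℝ := LinearMap.proj i
  ((t : ℕ) - (z : ℕ) : ℝ) • (e x - e y) - ((y : ℕ) - (x : ℕ) : ℝ) • (e z - e t)

theorem slopeForm_apply {n : ℕ} (x y z t : Fin (n + 1)) (a : Fin (n + 1) → ℝ) :
    slopeForm x y z t a = slopeDefect x y z t 0 0 a := by
  simp [slopeForm, slopeDefect]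

/-- The two pairs may share `y`. Its coefficient is then `x - t` (if `z = y`) or `z - x` (if `t =
y`), so nothing cancels as long as `x` is not shared. -/
theorem slopeForm_single_ne_zero_iff {n : ℕ} {x y z t : Fin (n + 1)} (hxy : x ≠ y) (hzt : z ≠ t)
    (hx : x ≠ z) (hx' : x ≠ t) (s : Fin (n + 1)) :
    slopeForm x y z t (Pi.single s 1) ≠ 0 ↔ s ∈ ({x, y, z, t} : Finset (Fin (n + 1))) := by
  have h1 := natCast_sub_ne_zero hxy
  have h2 := natCast_sub_ne_zero hzt
  have h2' := natCast_sub_ne_zero hzt.symm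
  have h3 := natCast_sub_ne_zero hx
  have h4 := natCast_sub_ne_zero hx'
  have h1' := natCast_sub_ne_zero hxy.symm
  simp only [slopeForm_apply, slopeDefect, Pi.single_apply, Finset.mem_insert,
    Finset.mem_singleton]
  by_cases e1 : x = s
  · subst e1
    simp [hxy.symm, Ne.symm hx, Ne.symm hx', h2']
  by_cases e2 : y = s
  · subst e2
    by_cases e3 : z = y
    · subst e3
      have : t ≠ z := hzt.symm
      simp only [e1, this, if_true, if_false]
      simp only [or_true, true_or, iff_true]
      intro h
      apply h4
      linarith
    · by_cases e4 : t = y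
      · subst e4
        simp only [e1, hzt, if_true, if_false]
        simp only [or_true, iff_true]
        intro h
        apply h3
        linarith
      · simp [e1, e3, e4, h2]
  · by_cases e3 : z = s
    · subst e3
      simp [e1, e2, hzt.symm, h1]
    · by_cases e4 : t = s
      · subst e4
        simp [e1, e2, e3, h1']
      · simp [e1, e2, e3, e4, Ne.symm e1, Ne.symm e2, Ne.symm e3, Ne.symm e4]

theorem finrank_ker_of_ne_zero {n : ℕ} {l : (Fin (n + 1) → ℝ) →ₗ[ℝ] ℝ} (hl : l ≠ 0) :
    Module.finrank ℝ (LinearMap.ker l) = n := by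
  have h1 := LinearMap.finrank_range_add_finrank_ker l
  rw [LinearMap.range_eq_top.2 (LinearMap.surjective hl), finrank_top] at h1
  simp at h1
  omega

theorem vectorSpan_le_ker_of_forall_sub {n : ℕ} {P : Set (Fin (n + 1) → ℝ)}
    {l : (Fin (n + 1) → ℝ) →ₗ[ℝ] ℝ} (h : ∀ a ∈ P, ∀ q ∈ P, l a = l q) :
    vectorSpan ℝ P ≤ LinearMap.ker l := by
  rw [vectorSpan_def, Submodule.span_le]
  rintro _ ⟨a, ha, q, hq, rfl⟩
  simp [h a ha q hq]

theorem IsTopCell.vectorSpan_eq_ker {n : ℕ} {P : Set (Fin (n + 1) → ℝ)} (hP : IsTopCell P)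
    {l : (Fin (n + 1) → ℝ) →ₗ[ℝ] ℝ} (hl : l ≠ 0) (h : ∀ a ∈ P, ∀ q ∈ P, l a = l q) :
    vectorSpan ℝ P = LinearMap.ker l :=
  Submodule.eq_of_le_of_finrank_eq (vectorSpan_le_ker_of_forall_sub h)
    (hP.2.2.trans (finrank_ker_of_ne_zero hl).symm)

/-- The monomials `x ≠ y` of `a` differ at `b` by a constant that occurs as a difference of
valuations of integers. -/
def Tied {n : ℕ} (a : Fin (n + 1) → ℝ) (b : ℝ) (x y : Fin (n + 1)) : Prop :=
  x ≠ y ∧ ∃ c ∈ Finset.Icc (-n : ℤ) n, monomialValue a b x + c = monomialValue a b y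

/-- A point of `P` at which no accidental coincidence of ties happens. -/
def IsTieGeneric {n : ℕ} (P : Set (Fin (n + 1) → ℝ)) (a : Fin (n + 1) → ℝ) : Prop :=
  a ∈ P ∧ ∀ x y z t, ∀ c ∈ Finset.Icc (-n : ℤ) n, ∀ c' ∈ Finset.Icc (-n : ℤ) n,
    slopeDefect x y z t c c' a = 0 → ∀ q ∈ P, slopeDefect x y z t c c' q = 0

theorem IsTopCell.subset_closure_isTieGeneric {n : ℕ} {P : Set (Fin (n + 1) → ℝ)}
    (hP : IsTopCell P) : P ⊆ closure {a | IsTieGeneric P a} := by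
  let F := Fin (n + 1)
  let s : Finset (F × F × F × F × ℤ × ℤ) := Finset.univ ×ˢ Finset.univ ×ˢ Finset.univ ×ˢ
    Finset.univ ×ˢ Finset.Icc (-n : ℤ) n ×ˢ Finset.Icc (-n : ℤ) n
  refine (hP.2.1.subset_closure_generic
    (fun (i : F × F × F × F × ℤ × ℤ) a =>
      slopeDefect i.1 i.2.1 i.2.2.1 i.2.2.2.1 i.2.2.2.2.1 i.2.2.2.2.2 a) ?_ ?_ s).trans
    (closure_mono ?_)
  · intro i
    unfold slopeDefect
    fun_prop
  · intro i a q t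
    simp only [slopeDefect, Pi.add_apply, Pi.smul_apply, Pi.sub_apply, smul_eq_mul]
    ring
  · rintro a ⟨ha, h⟩
    refine ⟨ha, fun x y z t c hc c' hc' => h (x, y, z, t, c, c') ?_⟩
    simp only [s, Finset.mem_product, Finset.mem_univ, true_and]
    exact ⟨hc, hc'⟩

theorem IsTopCell.exists_isTieGeneric {n : ℕ} {P : Set (Fin (n + 1) → ℝ)}
    (hP : IsTopCell P) : ∃ a, IsTieGeneric P a := by
  obtain ⟨a, ha⟩ := hP.1
  exact closure_nonempty_iff.1 ⟨a, hP.subset_closure_isTieGeneric ha⟩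

/-- Both ties determine the same `b`. Eliminating it leaves an affine relation from the finite list
in `IsTieGeneric`, which then holds on all of `P`. -/
theorem IsTieGeneric.exists_slopeDefect {n : ℕ} {P : Set (Fin (n + 1) → ℝ)}
    {a : Fin (n + 1) → ℝ} (ha : IsTieGeneric P a) {b : ℝ} {x y z t : Fin (n + 1)}
    (hxy : Tied a b x y) (hzt : Tied a b z t) :
    ∃ c c' : ℝ, ∀ q ∈ P, slopeDefect x y z t c c' q = 0 := by
  obtain ⟨-, c, hc, h1⟩ := hxy
  obtain ⟨-, c', hc', h2⟩ := hzt
  refine ⟨c, c', ha.2 x y z t c hc c' hc' ?_⟩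
  simp only [monomialValue] at h1 h2
  have e1 : a x - a y + c = ((y : ℕ) - (x : ℕ)) * b := by linarith
  have e2 : a z - a t + c' = ((t : ℕ) - (z : ℕ)) * b := by linarith
  rw [slopeDefect, e1, e2]
  ring

theorem slopeForm_ne_zero {n : ℕ} {x y z t : Fin (n + 1)} (hxy : x ≠ y) (hzt : z ≠ t)
    (hx : x ≠ z) (hx' : x ≠ t) : slopeForm x y z t ≠ 0 := fun h =>
  (slopeForm_single_ne_zero_iff hxy hzt hx hx' x).2 (by simp) (by simp [h])

theorem IsTopCell.vectorSpan_eq_ker_slopeForm {n : ℕ} {P : Set (Fin (n + 1) → ℝ)}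
    (hP : IsTopCell P) {x y z t : Fin (n + 1)} (hxy : x ≠ y) (hzt : z ≠ t) (hx : x ≠ z)
    (hx' : x ≠ t) {c c' : ℝ} (h : ∀ q ∈ P, slopeDefect x y z t c c' q = 0) :
    vectorSpan ℝ P = LinearMap.ker (slopeForm x y z t) := by
  refine hP.vectorSpan_eq_ker (slopeForm_ne_zero hxy hzt hx hx') fun a ha q hq => ?_
  have h1 := h a ha
  have h2 := h q hq
  simp only [slopeForm_apply, slopeDefect] at *
  linarith

/-- At a generic point of a top-dimensional cell, any two pairs of independent ties involve the
same monomials. -/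
theorem IsTopCell.ties_eq {n : ℕ} {P : Set (Fin (n + 1) → ℝ)} (hP : IsTopCell P)
    {a : Fin (n + 1) → ℝ} (ha : IsTieGeneric P a) {b b' : ℝ}
    {x y z t x' y' z' t' : Fin (n + 1)} (hxy : Tied a b x y) (hzt : Tied a b z t)
    (hx : x ≠ z) (hx' : x ≠ t) (hxy' : Tied a b' x' y') (hzt' : Tied a b' z' t')
    (h : x' ≠ z') (h' : x' ≠ t') :
    ({x, y, z, t} : Finset (Fin (n + 1))) = {x', y', z', t'} := by
  obtain ⟨c, c', h1⟩ := ha.exists_slopeDefect hxy hzt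
  obtain ⟨d, d', h2⟩ := ha.exists_slopeDefect hxy' hzt'
  -- Both forms have the direction space of `P` as kernel, and the support of a form can be read off
  -- from which unit vectors lie in its kernel.
  have e := (hP.vectorSpan_eq_ker_slopeForm hxy.1 hzt.1 hx hx' h1).symm.trans
    (hP.vectorSpan_eq_ker_slopeForm hxy'.1 hzt'.1 h h' h2)
  ext s
  rw [← slopeForm_single_ne_zero_iff hxy.1 hzt.1 hx hx',
    ← slopeForm_single_ne_zero_iff hxy'.1 hzt'.1 h h', not_iff_not, ← LinearMap.mem_ker, e,
    LinearMap.mem_ker]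

theorem tied_of_eq {n : ℕ} {a : Fin (n + 1) → ℝ} {b : ℝ} {x y : Fin (n + 1)} (hxy : x ≠ y)
    (h : monomialValue a b x = monomialValue a b y) : Tied a b x y :=
  ⟨hxy, 0, by simp, by simpa using h⟩

theorem monomialValue_eq_of_mem_minMonomials {n : ℕ} {a : Fin (n + 1) → ℝ} {b : ℝ}
    {x y : Fin (n + 1)} (hx : x ∈ minMonomials a b) (hy : y ∈ minMonomials a b) :
    monomialValue a b x = monomialValue a b y :=
  le_antisymm (hx y) (hy x)

theorem tied_of_mem_minMonomials {n : ℕ} {a : Fin (n + 1) → ℝ} {b : ℝ} {x y : Fin (n + 1)}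
    (hxy : x ≠ y) (hx : x ∈ minMonomials a b) (hy : y ∈ minMonomials a b) : Tied a b x y :=
  tied_of_eq hxy (monomialValue_eq_of_mem_minMonomials hx hy)

theorem minMonomials_nonempty {n : ℕ} (a : Fin (n + 1) → ℝ) (b : ℝ) :
    (minMonomials a b).Nonempty :=
  Finite.exists_min (monomialValue a b)

/-! ### The loci in the two settings -/

/-- The `p`-adic valuation of the difference of two indices. -/
def indexVal (p : ℕ) {n : ℕ} (i j : Fin (n + 1)) : ℕ :=
  padicValInt p ((i : ℕ) - (j : ℕ) : ℤ)

/-- The `p`-adic tropical pairs of a polynomial and a double root. -/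
def padicLocus (p n : ℕ) : Set ((Fin (n + 1) → ℝ) × ℝ) :=
  circuitLocus (fun i j => i ≠ j) (indexVal p)

/-- The tropical pairs of a polynomial and a double root in characteristic `p`. -/
def charLocus (p n : ℕ) : Set ((Fin (n + 1) → ℝ) × ℝ) :=
  circuitLocus (fun i j => ¬ (i : ℕ) ≡ j [MOD p]) (indexVal p)

theorem intCast_dvd_sub_iff {p n : ℕ} {i j : Fin (n + 1)} :
    (p : ℤ) ∣ (i : ℕ) - (j : ℕ) ↔ (i : ℕ) ≡ j [MOD p] := by
  rw [Nat.ModEq.comm, Nat.modEq_iff_dvd]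

theorem indexVal_eq_zero {p n : ℕ} {i j : Fin (n + 1)} (h : ¬ (i : ℕ) ≡ j [MOD p]) :
    indexVal p i j = 0 := by
  rw [indexVal, padicValInt]
  apply padicValNat.eq_zero_of_not_dvd
  rwa [← Int.natCast_dvd, intCast_dvd_sub_iff]

theorem indexVal_pos {p n : ℕ} (hp : p.Prime) {i j : Fin (n + 1)} (hij : i ≠ j)
    (h : (i : ℕ) ≡ j [MOD p]) : 1 ≤ indexVal p i j := by
  have := Fact.mk hp
  rw [indexVal, padicValInt]
  apply one_le_padicValNat_of_dvd
  · have := Fin.val_ne_of_ne hij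
    omega
  · rwa [← Int.natCast_dvd, intCast_dvd_sub_iff]

theorem indexVal_le {p n : ℕ} (hp : p.Prime) (i j : Fin (n + 1)) : indexVal p i j ≤ n := by
  by_cases hij : i = j
  · simp [indexVal, hij]
  have := Fact.mk hp
  have h0 : ((i : ℕ) - (j : ℕ) : ℤ).natAbs ≠ 0 := by
    have := Fin.val_ne_of_ne hij
    omega
  have h1 : p ^ indexVal p i j ≤ ((i : ℕ) - (j : ℕ) : ℤ).natAbs :=
    Nat.le_of_dvd (Nat.pos_of_ne_zero h0) pow_padicValNat_dvd
  have h2 := Nat.lt_pow_self (n := indexVal p i j) hp.one_lt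
  omega

theorem tied_of_indexVal {p n : ℕ} (hp : p.Prime) {a : Fin (n + 1) → ℝ} {b : ℝ}
    {x y j : Fin (n + 1)} (hxy : x ≠ y)
    (h : monomialValue a b x + indexVal p x j = monomialValue a b y + indexVal p y j) :
    Tied a b x y := by
  refine ⟨hxy, (indexVal p x j : ℤ) - indexVal p y j, ?_, ?_⟩
  · have h1 := indexVal_le hp x j
    have h2 := indexVal_le hp y j
    rw [Finset.mem_Icc]
    omega
  · push_cast
    linarith

/-- In characteristic `p`, the minimum of the monomials outside the class of `j` is attained
twice. -/
theorem exists_of_mem_charLocus {p n : ℕ} {a : Fin (n + 1) → ℝ} {b : ℝ}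
    (h : (a, b) ∈ charLocus p n) (j : Fin (n + 1)) :
    ∃ x y : Fin (n + 1), x ≠ y ∧ ¬ (x : ℕ) ≡ j [MOD p] ∧ ¬ (y : ℕ) ≡ j [MOD p] ∧
      monomialValue a b x = monomialValue a b y ∧
      ∀ i : Fin (n + 1), ¬ (i : ℕ) ≡ j [MOD p] → monomialValue a b x ≤ monomialValue a b i := by
  obtain ⟨x, y, hxy, hx, hy, hm⟩ := h j
  have hm' : ∀ i : Fin (n + 1), ¬ (i : ℕ) ≡ j [MOD p] →
      monomialValue a b x ≤ monomialValue a b i ∧ monomialValue a b y ≤ monomialValue a b i := by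
    intro i hi
    simpa [indexVal_eq_zero hi, indexVal_eq_zero hx, indexVal_eq_zero hy] using hm i hi
  exact ⟨x, y, hxy, hx, hy, le_antisymm (hm' y hy).1 (hm' x hx).2, fun i hi => (hm' i hi).1⟩

/-- The circuit of an index incongruent to a minimal `l` contains `l`, so its two minimal terms `x`,
`y` are globally minimal. In the circuit of `x`, either `y` occurs and the tie found there is
minimal too, or `y ≡ x` and that tie avoids both. -/
theorem charLocus_dichotomy {p n : ℕ} {a : Fin (n + 1) → ℝ} {b : ℝ}
    (h : (a, b) ∈ charLocus p n) :
    (∃ i ∈ minMonomials a b, ∃ j ∈ minMonomials a b, ∃ k ∈ minMonomials a b,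
      i ≠ j ∧ i ≠ k ∧ j ≠ k) ∨
    ∃ l ∈ minMonomials a b, ∃ m ∈ minMonomials a b, ∃ s t : Fin (n + 1), l ≠ m ∧ s ≠ t ∧
      l ≠ s ∧ l ≠ t ∧ m ≠ s ∧ m ≠ t ∧ monomialValue a b s = monomialValue a b t := by
  obtain ⟨l, hl⟩ := minMonomials_nonempty a b
  obtain ⟨j, -, -, hj, -⟩ := exists_of_mem_charLocus h l
  obtain ⟨x, y, hxy, -, -, he, hm⟩ := exists_of_mem_charLocus h j
  have hlj := hm l fun h => hj h.symm
  have hx : x ∈ minMonomials a b := fun i => hlj.trans (hl i)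
  have hy : y ∈ minMonomials a b := fun i => he ▸ hx i
  obtain ⟨s, t, hst, hs, ht, he', hm'⟩ := exists_of_mem_charLocus h x
  have hsx : x ≠ s := fun e => hs (e ▸ rfl)
  have htx : x ≠ t := fun e => ht (e ▸ rfl)
  by_cases hc : (y : ℕ) ≡ x [MOD p]
  · exact Or.inr ⟨x, hx, y, hy, s, t, hxy, hst, hsx, htx, fun e => hs (e ▸ hc),
      fun e => ht (e ▸ hc), he'⟩
  · have hs' : s ∈ minMonomials a b := fun i => (hm' y hc).trans (hy i)
    exact Or.inl ⟨x, hx, s, hs', t, fun i => he' ▸ hs' i, hsx, htx, hst⟩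

/-- At a generic point of a cell in characteristic `p` that has a triple tie somewhere,
this tie is at the minimum at any double root. -/
theorem mem_minMonomials_of_charLocus {p n : ℕ} {P : Set (Fin (n + 1) → ℝ)} (hP : IsTopCell P)
    {a : Fin (n + 1) → ℝ} (ha : IsTieGeneric P a) {b b' : ℝ} {i j k : Fin (n + 1)}
    (hik : i ≠ k) (hij' : Tied a b i j) (hkj' : Tied a b k j) (h : (a, b') ∈ charLocus p n) :
    i ∈ minMonomials a b' ∧ j ∈ minMonomials a b' ∧ k ∈ minMonomials a b' := by
  have key := fun {x y z t : Fin (n + 1)} (hxy : Tied a b' x y) (hzt : Tied a b' z t)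
    (hx : x ≠ z) (hx' : x ≠ t) => hP.ties_eq ha hij' hkj' hik hij'.1 hxy hzt hx hx'
  rcases charLocus_dichotomy h with ⟨x, hx, y, hy, z, hz, hxy, hxz, hyz⟩ |
    ⟨l, hl, m, hm, s, t, hlm, hst, hls, hlt, hms, hmt, he⟩
  · have e := key (tied_of_mem_minMonomials hxy hx hy) (tied_of_mem_minMonomials hyz.symm hz hy)
      hxz hxy
    have hsub : ∀ w ∈ ({x, y, z, y} : Finset (Fin (n + 1))), w ∈ minMonomials a b' := by
      simp [hx, hy, hz]
    rw [← e] at hsub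
    exact ⟨hsub i (by simp), hsub j (by simp), hsub k (by simp)⟩
  · have e := key (tied_of_mem_minMonomials hlm hl hm) (tied_of_eq hst he) hls hlt
    -- Two disjoint ties would have a support of four monomials, but the given ties share `j`.
    have h4 : ({l, m, s, t} : Finset (Fin (n + 1))).card = 4 := by
      simp [hlm, hls, hlt, hms, hmt, hst]
    have h3 : ({i, j, k, j} : Finset (Fin (n + 1))).card ≤ 3 := by
      rw [show ({i, j, k, j} : Finset (Fin (n + 1))) = {i, j, k} by ext; simp; tauto]
      exact Finset.card_le_three
    rw [e] at h3
    omega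

/-! ### Cells in the hyperplane of a triple tie -/

theorem isClosed_tripleCone {n : ℕ} {i j k : Fin (n + 1)} (hij : i ≠ j) :
    IsClosed (tripleCone i j k) := by
  have key : tripleCone i j k = {a : Fin (n + 1) → ℝ | ∀ l,
      monomialValue a ((a i - a j) / ((j : ℕ) - (i : ℕ))) i ≤
        monomialValue a ((a i - a j) / ((j : ℕ) - (i : ℕ))) l ∧
      monomialValue a ((a i - a j) / ((j : ℕ) - (i : ℕ))) j ≤
        monomialValue a ((a i - a j) / ((j : ℕ) - (i : ℕ))) l ∧
      monomialValue a ((a i - a j) / ((j : ℕ) - (i : ℕ))) k ≤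
        monomialValue a ((a i - a j) / ((j : ℕ) - (i : ℕ))) l} := by
    ext a
    constructor
    · rintro ⟨b, hi, hj, hk⟩
      have : (a i - a j) / ((j : ℕ) - (i : ℕ)) = b := by
        rw [div_eq_iff (natCast_sub_ne_zero hij.symm)]
        have := monomialValue_eq_of_mem_minMonomials hi hj
        simp only [monomialValue] at this
        linarith
      rw [Set.mem_ofPred_eq, this]
      exact fun l => ⟨hi l, hj l, hk l⟩
    · intro h
      exact ⟨_, fun l => (h l).1, fun l => (h l).2.1, fun l => (h l).2.2⟩
  rw [key]
  simp only [monomialValue, Set.ofPred_forall, Set.ofPred_and]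
  exact isClosed_iInter fun l => (isClosed_le (by fun_prop) (by fun_prop)).inter <|
    (isClosed_le (by fun_prop) (by fun_prop)).inter (isClosed_le (by fun_prop) (by fun_prop))

/-- The linear form vanishing on `tripleCone i j k`. -/
def tripleForm {n : ℕ} (i j k : Fin (n + 1)) : (Fin (n + 1) → ℝ) →ₗ[ℝ] ℝ := slopeForm i j k j

theorem exists_ties_of_mem_ker {n : ℕ} {i j k : Fin (n + 1)} (hij : i ≠ j) (hjk : j ≠ k)
    {a : Fin (n + 1) → ℝ} (ha : a ∈ LinearMap.ker (tripleForm i j k)) :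
    ∃ b, monomialValue a b i = monomialValue a b j ∧ monomialValue a b k = monomialValue a b j := by
  rw [LinearMap.mem_ker, tripleForm, slopeForm_apply, slopeDefect] at ha
  have h1 := natCast_sub_ne_zero hij.symm
  have h2 := natCast_sub_ne_zero hjk
  refine ⟨(a i - a j) / ((j : ℕ) - (i : ℕ)), ?_, ?_⟩
  · simp only [monomialValue]
    field_simp
    ring
  · simp only [monomialValue]
    field_simp
    linarith

theorem mem_ker_tripleForm {n : ℕ} {i j k : Fin (n + 1)} {a : Fin (n + 1) → ℝ} {b : ℝ}
    (h1 : monomialValue a b i = monomialValue a b j)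
    (h2 : monomialValue a b k = monomialValue a b j) : a ∈ LinearMap.ker (tripleForm i j k) := by
  simp only [monomialValue] at h1 h2
  have e1 : a i - a j = ((j : ℕ) - (i : ℕ)) * b := by linarith
  have e2 : a k - a j = ((j : ℕ) - (k : ℕ)) * b := by linarith
  rw [LinearMap.mem_ker, tripleForm, slopeForm_apply, slopeDefect, e1, e2]
  ring

/-- This gives maximality of the cones in characteristic `p`: on the hyperplane the triple is tied
at some `b`, at generic points it is then minimal at every double root, and the cone is closed. -/
theorem subset_tripleCone_of_subset_charLocus {p n : ℕ} {Q : Set (Fin (n + 1) → ℝ)}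
    (hQ : IsTopCell Q) {i j k : Fin (n + 1)} (hij : i ≠ j) (hik : i ≠ k) (hjk : j ≠ k)
    (hk : Q ⊆ LinearMap.ker (tripleForm i j k)) (h : Q ⊆ Prod.fst '' charLocus p n) :
    Q ⊆ tripleCone i j k := by
  refine hQ.subset_closure_isTieGeneric.trans (closure_minimal ?_ (isClosed_tripleCone hij))
  intro a ha
  obtain ⟨b, h1, h2⟩ := exists_ties_of_mem_ker hij hjk (hk ha.1)
  obtain ⟨⟨_, b'⟩, hb, rfl⟩ := h ha.1
  exact ⟨b', mem_minMonomials_of_charLocus hQ ha hik (tied_of_eq hij h1)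
    (tied_of_eq hjk.symm h2) hb⟩

theorem exists_of_mem_padicLocus {p n : ℕ} (hp : p.Prime) {a : Fin (n + 1) → ℝ} {b : ℝ}
    (h : (a, b) ∈ padicLocus p n) (j : Fin (n + 1)) :
    ∃ x y, Tied a b x y ∧ x ≠ j ∧ y ≠ j ∧
      monomialValue a b x + indexVal p x j = monomialValue a b y + indexVal p y j ∧
      ∀ i : Fin (n + 1), i ≠ j →
        monomialValue a b x + indexVal p x j ≤ monomialValue a b i + indexVal p i j := by
  obtain ⟨x, y, hxy, hx, hy, hm⟩ := h j
  have e := le_antisymm (hm y hy).1 (hm x hx).2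
  exact ⟨x, y, tied_of_indexVal hp hxy e, hx, hy, e, fun i hi => (hm i hi).1⟩

/-- At generic points every circuit attains its minimum at two of `i`, `j`, `k`. The circuit of `i`
therefore ties `j` with `k`, and that of `j` ties `i` with `k`, without shifts because the indices
are incongruent. -/
theorem subset_tripleCone_of_subset_padicLocus {p n : ℕ} (hp : p.Prime)
    {Q : Set (Fin (n + 1) → ℝ)} (hQ : IsTopCell Q) {i j k : Fin (n + 1)}
    (hij : ¬ (i : ℕ) ≡ j [MOD p]) (hik : ¬ (i : ℕ) ≡ k [MOD p]) (hjk : ¬ (j : ℕ) ≡ k [MOD p])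
    (hk : Q ⊆ LinearMap.ker (tripleForm i j k)) (h : Q ⊆ Prod.fst '' padicLocus p n) :
    Q ⊆ tripleCone i j k := by
  have hij' : i ≠ j := fun e => hij (e ▸ rfl)
  have hik' : i ≠ k := fun e => hik (e ▸ rfl)
  have hjk' : j ≠ k := fun e => hjk (e ▸ rfl)
  refine hQ.subset_closure_isTieGeneric.trans (closure_minimal ?_ (isClosed_tripleCone hij'))
  intro a ha
  obtain ⟨b, h1, h2⟩ := exists_ties_of_mem_ker hij' hjk' (hk ha.1)
  obtain ⟨⟨a, b'⟩, hb, rfl⟩ := h ha.1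
  dsimp only at ha h1 h2 ⊢
  have key : ∀ l, ∃ x y, x ≠ y ∧ x ≠ l ∧ y ≠ l ∧ (x = i ∨ x = j ∨ x = k) ∧
      (y = i ∨ y = j ∨ y = k) ∧
      monomialValue a b' x + indexVal p x l = monomialValue a b' y + indexVal p y l ∧
      ∀ i : Fin (n + 1), i ≠ l →
        monomialValue a b' x + indexVal p x l ≤ monomialValue a b' i + indexVal p i l := by
    intro l
    obtain ⟨x, y, hxy, hx, hy, he, hm⟩ := exists_of_mem_padicLocus hp hb l
    -- The second tie comes from the circuit of `x`, so that it does not involve `x`.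
    obtain ⟨z, t, hzt, hz, ht, -⟩ := exists_of_mem_padicLocus hp hb x
    have e := hQ.ties_eq ha hxy hzt hz.symm ht.symm (tied_of_eq hij' h1)
      (tied_of_eq hjk'.symm h2) hik' hij'
    have hx' : x ∈ ({x, y, z, t} : Finset (Fin (n + 1))) := by simp
    have hy' : y ∈ ({x, y, z, t} : Finset (Fin (n + 1))) := by simp
    rw [e] at hx' hy'
    simp only [Finset.mem_insert, Finset.mem_singleton] at hx' hy'
    exact ⟨x, y, hxy.1, hx, hy, by tauto, by tauto, he, hm⟩
  have c1 := indexVal_eq_zero hij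
  have c2 := indexVal_eq_zero hik
  have c3 := indexVal_eq_zero hjk
  have c1' := indexVal_eq_zero fun h => hij h.symm
  have c2' := indexVal_eq_zero fun h => hik h.symm
  have c3' := indexVal_eq_zero fun h => hjk h.symm
  have ki : monomialValue a b' j = monomialValue a b' k ∧ ∀ l, l ≠ i →
      monomialValue a b' j ≤ monomialValue a b' l + indexVal p l i := by
    obtain ⟨x, y, hxy, hx, hy, hx', hy', he, hm⟩ := key i
    rcases hx' with rfl | rfl | rfl <;> rcases hy' with rfl | rfl | rfl <;>
      simp_all
  have kj : monomialValue a b' i = monomialValue a b' k ∧ ∀ l, l ≠ j →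
      monomialValue a b' i ≤ monomialValue a b' l + indexVal p l j := by
    obtain ⟨x, y, hxy, hx, hy, hx', hy', he, hm⟩ := key j
    rcases hx' with rfl | rfl | rfl <;> rcases hy' with rfl | rfl | rfl <;>
      simp_all
  have hi : i ∈ minMonomials a b' := by
    intro l
    -- Every `l` is incongruent to `i` or to `j`; the corresponding circuit bounds its value without
    -- a shift.
    by_cases hl : (l : ℕ) ≡ i [MOD p]
    · have hl' : ¬ (l : ℕ) ≡ j [MOD p] := fun h => hij (hl.symm.trans h)
      have := kj.2 l fun e => hl' (e ▸ rfl)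
      rw [indexVal_eq_zero hl'] at this
      simpa using this
    · have := ki.2 l fun e => hl (e ▸ rfl)
      rw [indexVal_eq_zero hl] at this
      rw [kj.1, ← ki.1]
      simpa using this
  exact ⟨b', hi, fun l => (ki.1.trans kj.1.symm) ▸ hi l, fun l => kj.1 ▸ hi l⟩

/-- At a `p`-adic double root there are two independent ties among monomials whose values differ
by at most `n`. -/
theorem exists_close_ties_of_mem_padicLocus {p n : ℕ} (hp : p.Prime) {a : Fin (n + 1) → ℝ}
    {b : ℝ} (h : (a, b) ∈ padicLocus p n) :
    ∃ x y z t, Tied a b x y ∧ Tied a b z t ∧ x ≠ z ∧ x ≠ t ∧ ∃ c : ℝ,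
      ∀ w ∈ ({x, y, z, t} : Finset (Fin (n + 1))),
        c ≤ monomialValue a b w ∧ monomialValue a b w ≤ c + n := by
  obtain ⟨m, hm⟩ := minMonomials_nonempty a b
  -- The circuit of `j ≠ m` contains the minimal monomial `m` with a shift of at most `n`.
  have main : ∀ j, j ≠ m → ∃ x y, Tied a b x y ∧ x ≠ j ∧ y ≠ j ∧
      monomialValue a b x ≤ monomialValue a b m + n ∧
      monomialValue a b y ≤ monomialValue a b m + n := by
    intro j hj
    obtain ⟨x, y, hxy, hx, hy, he, hmin⟩ := exists_of_mem_padicLocus hp h j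
    have h1 := hmin m hj.symm
    have h2 : (indexVal p m j : ℝ) ≤ n := by exact_mod_cast indexVal_le hp m j
    have h3 : (0 : ℝ) ≤ indexVal p x j := by positivity
    have h4 : (0 : ℝ) ≤ indexVal p y j := by positivity
    exact ⟨x, y, hxy, hx, hy, by linarith, by linarith⟩
  obtain ⟨j, -, -, hj, -⟩ := exists_of_mem_padicLocus hp h m
  obtain ⟨x, y, hxy, -, -, hx, hy⟩ := main j hj
  have finish : ∀ x y, Tied a b x y → x ≠ m → monomialValue a b x ≤ monomialValue a b m + n →
      monomialValue a b y ≤ monomialValue a b m + n →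
      ∃ x y z t, Tied a b x y ∧ Tied a b z t ∧ x ≠ z ∧ x ≠ t ∧ ∃ c : ℝ,
      ∀ w ∈ ({x, y, z, t} : Finset (Fin (n + 1))),
        c ≤ monomialValue a b w ∧ monomialValue a b w ≤ c + n := by
    intro x y hxy hxm hx hy
    obtain ⟨z, t, hzt, hz, ht, hz', ht'⟩ := main x hxm
    refine ⟨x, y, z, t, hxy, hzt, hz.symm, ht.symm, monomialValue a b m, fun w hw => ⟨hm w, ?_⟩⟩
    simp only [Finset.mem_insert, Finset.mem_singleton] at hw
    rcases hw with rfl | rfl | rfl | rfl <;> assumption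
  -- The second circuit must contain `m`, so it is taken at an end of the first tie other than `m`.
  by_cases hxm : x = m
  · refine finish y x ?_ (fun e => hxy.1 (hxm.trans e.symm)) hy hx
    obtain ⟨h1, c, hc, h2⟩ := hxy
    refine ⟨h1.symm, -c, ?_, ?_⟩
    · rw [Finset.mem_Icc] at *
      omega
    · push_cast
      linarith
  · exact finish x y hxy hxm hx hy

/-! ### Equality of the discriminants near the origin -/

theorem exists_not_modEq {p n : ℕ} (hp : p.Prime) (hn : 1 ≤ n) (j : Fin (n + 1)) :
    ∃ i : Fin (n + 1), ¬ (i : ℕ) ≡ j [MOD p] := by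
  have h1 := hp.two_le
  by_cases hj : (j : ℕ) = 0
  · refine ⟨⟨1, by omega⟩, ?_⟩
    rw [← intCast_dvd_sub_iff, hj]
    exact fun h => absurd (Int.le_of_dvd (by simp) h) (by simp; omega)
  · refine ⟨⟨j - 1, by omega⟩, ?_⟩
    rw [Nat.ModEq.comm, ← intCast_dvd_sub_iff]
    dsimp only
    rw [show ((j : ℕ) - ((j - 1 : ℕ) : ℕ) : ℤ) = 1 by omega]
    exact fun h => absurd (Int.le_of_dvd (by simp) h) (by omega)

theorem one_le_of_mem_circuitLocus {n : ℕ} {E : Fin (n + 1) → Fin (n + 1) → Prop}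
    {D : Fin (n + 1) → Fin (n + 1) → ℕ} {q : (Fin (n + 1) → ℝ) × ℝ} (h : q ∈ circuitLocus E D) :
    1 ≤ n := by
  obtain ⟨x, y, hxy, -⟩ := h 0
  have := Fin.val_ne_of_ne hxy
  omega

/-- The circuit of `1` omits `1` and contains `0` unshifted, so some `z ≥ 2` satisfies `a z + z * b
≤ a 0`, whence `b ≤ 2 * ε / z ≤ ε`. The circuit of `n - 1` gives the lower bound in the same way. -/
theorem abs_le_of_mem_circuitLocus {n : ℕ} {E : Fin (n + 1) → Fin (n + 1) → Prop}
    {D : Fin (n + 1) → Fin (n + 1) → ℕ} (hE : ∀ j, ¬ E j j)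
    (hD : ∀ i j : Fin (n + 1), (i : ℕ) + 1 = j ∨ (j : ℕ) + 1 = i → E i j ∧ D i j = 0)
    {a : Fin (n + 1) → ℝ} {b ε : ℝ} (ha : ∀ i, |a i| ≤ ε) (h : (a, b) ∈ circuitLocus E D) :
    |b| ≤ ε := by
  have hn := one_le_of_mem_circuitLocus h
  have hε : 0 ≤ ε := (abs_nonneg _).trans (ha 0)
  have pick : ∀ i j : Fin (n + 1), (i : ℕ) + 1 = j ∨ (j : ℕ) + 1 = i → ∃ z, z ≠ i ∧ z ≠ j ∧
      monomialValue a b z ≤ monomialValue a b i := by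
    intro i j hij
    obtain ⟨x, y, hxy, hx, hy, hm⟩ := h j
    obtain ⟨h1, h2⟩ := hm i (hD i j hij).1
    rw [(hD i j hij).2] at h1 h2
    have h3 : (0 : ℝ) ≤ D x j := by positivity
    have h4 : (0 : ℝ) ≤ D y j := by positivity
    have hj : ∀ {z}, E z j → z ≠ j := fun hz e => hE j (e ▸ hz)
    simp only [Nat.cast_zero, add_zero] at h1 h2
    by_cases hxi : x = i
    · exact ⟨y, fun e => hxy (hxi.trans e.symm), hj hy, by linarith⟩
    · exact ⟨x, hxi, hj hx, by linarith⟩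
  rw [abs_le]
  constructor
  · obtain ⟨z, hz, hz', hm⟩ := pick ⟨n, by omega⟩ ⟨n - 1, by omega⟩ (Or.inr (by simp; omega))
    simp only [ne_eq, Fin.ext_iff] at hz hz'
    have hz2 : (z : ℕ) + 2 ≤ n := by omega
    have hz3 : ((z : ℕ) : ℝ) + 2 ≤ n := by exact_mod_cast hz2
    simp only [monomialValue] at hm
    have h1 := abs_le.1 (ha z)
    have h2 := abs_le.1 (ha ⟨n, by omega⟩)
    by_contra! hb
    nlinarith
  · obtain ⟨z, hz, hz', hm⟩ := pick ⟨0, by omega⟩ ⟨1, by omega⟩ (Or.inl (by simp))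
    simp only [ne_eq, Fin.ext_iff] at hz hz'
    have hz2 : 2 ≤ (z : ℕ) := by omega
    have hz3 : (2 : ℝ) ≤ (z : ℕ) := by exact_mod_cast hz2
    simp only [monomialValue, Nat.cast_zero, zero_mul, add_zero] at hm
    have h1 := abs_le.1 (ha z)
    have h2 := abs_le.1 (ha ⟨0, by omega⟩)
    by_contra! hb
    nlinarith

theorem not_modEq_of_consecutive {p n : ℕ} (hp : p.Prime) {i j : Fin (n + 1)}
    (h : (i : ℕ) + 1 = j ∨ (j : ℕ) + 1 = i) : ¬ (i : ℕ) ≡ j [MOD p] := by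
  have := hp.two_le
  rw [← intCast_dvd_sub_iff]
  intro hd
  rw [← dvd_abs] at hd
  rcases h with h | h
  · rw [show |((i : ℕ) - (j : ℕ) : ℤ)| = 1 by rw [← h]; simp] at hd
    exact absurd (Int.le_of_dvd (by simp) hd) (by omega)
  · rw [show |((i : ℕ) - (j : ℕ) : ℤ)| = 1 by rw [← h]; simp] at hd
    exact absurd (Int.le_of_dvd (by simp) hd) (by omega)

theorem abs_monomialValue_lt {n : ℕ} {a : Fin (n + 1) → ℝ} {b ε : ℝ}
    (ha : ∀ i, |a i| < ε) (hb : |b| ≤ ε) (hs : ε ≤ 1 / (2 * (n + 1))) (i : Fin (n + 1)) :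
    |monomialValue a b i| < 1 / 2 := by
  have hi : ((i : ℕ) : ℝ) ≤ n := by exact_mod_cast Fin.is_le i
  have h1 : |monomialValue a b i| ≤ |a i| + (i : ℕ) * |b| := by
    refine (abs_add_le _ _).trans ?_
    rw [abs_mul, Nat.abs_cast]
  have h2 : ((i : ℕ) : ℝ) * |b| ≤ n * ε := by gcongr
  have h3 : ε * (2 * (n + 1)) ≤ 1 := by
    rwa [le_div_iff₀ (by positivity)] at hs
  have := ha i
  linarith

/-- The values are less than `1` apart, so a term congruent to `j`, shifted by at least `1`, exceeds
every incongruent term of the circuit of `j`. -/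
theorem mem_padicLocus_iff_mem_charLocus {p n : ℕ} (hp : p.Prime) (hn : 1 ≤ n)
    {a : Fin (n + 1) → ℝ} {b : ℝ} (h : ∀ i, |monomialValue a b i| < 1 / 2) :
    (a, b) ∈ padicLocus p n ↔ (a, b) ∈ charLocus p n := by
  constructor
  · intro hv j
    obtain ⟨x, y, hxy, hx, hy, hm⟩ := hv j
    obtain ⟨i, hi⟩ := exists_not_modEq hp hn j
    have hij : i ≠ j := fun e => hi (e ▸ rfl)
    have hmi := hm i hij
    rw [indexVal_eq_zero hi] at hmi
    have main : ∀ x : Fin (n + 1), x ≠ j →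
        monomialValue a b x + indexVal p x j ≤ monomialValue a b i + (0 : ℕ) →
        ¬ (x : ℕ) ≡ j [MOD p] := by
      intro x hx hm hc
      have h1 : (1 : ℝ) ≤ indexVal p x j := by exact_mod_cast indexVal_pos hp hx hc
      have h2 := abs_lt.1 (h x)
      have h3 := abs_lt.1 (h i)
      simp only [Nat.cast_zero] at hm
      linarith
    exact ⟨x, y, hxy, main x hx hmi.1, main y hy hmi.2, fun i hi => hm i fun e => hi (e ▸ rfl)⟩
  · intro hw j
    obtain ⟨x, y, hxy, hx, hy, hm⟩ := hw j
    refine ⟨x, y, hxy, fun e => hx (e ▸ rfl), fun e => hy (e ▸ rfl), fun i hi => ?_⟩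
    by_cases hc : (i : ℕ) ≡ j [MOD p]
    · have h1 : (1 : ℝ) ≤ indexVal p i j := by exact_mod_cast indexVal_pos hp hi hc
      rw [indexVal_eq_zero hx, indexVal_eq_zero hy]
      have h2 := abs_lt.1 (h x)
      have h3 := abs_lt.1 (h i)
      have h4 := abs_lt.1 (h y)
      simp only [Nat.cast_zero]
      constructor <;> linarith
    · exact hm i hc

theorem padicLocus_inter_ball_eq {p n : ℕ} (hp : p.Prime) {ε : ℝ} (hε : 0 < ε)
    (hs : ε ≤ 1 / (2 * (n + 1))) :
    Prod.fst '' padicLocus p n ∩ Metric.ball 0 ε = Prod.fst '' charLocus p n ∩ Metric.ball 0 ε := by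
  ext a
  simp only [Set.mem_inter_iff, and_congr_left_iff, Set.mem_image, Prod.exists, exists_and_right,
    exists_eq_right, mem_ball_zero_iff, pi_norm_lt_iff hε, Real.norm_eq_abs]
  intro ha
  refine exists_congr fun b => ⟨fun h => ?_, fun h => ?_⟩
  · have hb := abs_le_of_mem_circuitLocus (fun _ h => h rfl)
      (fun i j hij => ⟨fun e => not_modEq_of_consecutive hp hij (e ▸ rfl),
        indexVal_eq_zero (not_modEq_of_consecutive hp hij)⟩) (fun i => (ha i).le) h
    exact (mem_padicLocus_iff_mem_charLocus hp (one_le_of_mem_circuitLocus h)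
      (abs_monomialValue_lt ha hb hs)).1 h
  · have hb := abs_le_of_mem_circuitLocus (fun _ h => h rfl)
      (fun i j hij => ⟨not_modEq_of_consecutive hp hij,
        indexVal_eq_zero (not_modEq_of_consecutive hp hij)⟩) (fun i => (ha i).le) h
    exact (mem_padicLocus_iff_mem_charLocus hp (one_le_of_mem_circuitLocus h)
      (abs_monomialValue_lt ha hb hs)).2 h

/-! ### Type I cones as cells -/

theorem convex_tripleCone {n : ℕ} (i j k : Fin (n + 1)) : Convex ℝ (tripleCone i j k) := by
  rintro a ⟨b, hi, hj, hk⟩ a' ⟨b', hi', hj', hk'⟩ s t hs ht -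
  have key : ∀ x, x ∈ minMonomials a b → x ∈ minMonomials a' b' →
      x ∈ minMonomials (s • a + t • a') (s * b + t * b') := by
    intro x hx hx' y
    have h1 := mul_le_mul_of_nonneg_left (hx y) hs
    have h2 := mul_le_mul_of_nonneg_left (hx' y) ht
    simp only [monomialValue, Pi.add_apply, Pi.smul_apply, smul_eq_mul] at *
    linarith
  exact ⟨_, key i hi hi', key j hj hj', key k hk hk'⟩

/-- The vector that raises all monomials except `i`, `j`, `k`. -/
def complementVec {n : ℕ} (i j k : Fin (n + 1)) : Fin (n + 1) → ℝ := fun l =>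
  if l = i ∨ l = j ∨ l = k then 0 else 1

theorem monomialValue_add_smul_complementVec {n : ℕ} (i j k l : Fin (n + 1))
    (a : Fin (n + 1) → ℝ) (b t : ℝ) :
    monomialValue (a + t • complementVec i j k) b l =
      monomialValue a b l + if l = i ∨ l = j ∨ l = k then 0 else t := by
  simp only [monomialValue, complementVec, Pi.add_apply, Pi.smul_apply, smul_eq_mul]
  split_ifs <;> ring

theorem exists_add_smul_mem_tripleCone {n : ℕ} {i j k : Fin (n + 1)} (hij : i ≠ j) (hjk : j ≠ k)
    {a : Fin (n + 1) → ℝ} (ha : a ∈ LinearMap.ker (tripleForm i j k)) :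
    ∃ t₀ : ℝ, ∀ t, t₀ ≤ t → a + t • complementVec i j k ∈ tripleCone i j k := by
  obtain ⟨b, h1, h2⟩ := exists_ties_of_mem_ker hij hjk ha
  obtain ⟨t₀, ht₀⟩ := (Set.finite_range fun l => monomialValue a b j - monomialValue a b l).bddAbove
  have hb : ∀ l, monomialValue a b j - monomialValue a b l ≤ t₀ := fun l => ht₀ ⟨l, rfl⟩
  refine ⟨t₀, fun t ht => ?_⟩
  have key : ∀ x, x = i ∨ x = j ∨ x = k → x ∈ minMonomials (a + t • complementVec i j k) b := by
    intro x hx y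
    have hxj : monomialValue a b x = monomialValue a b j := by
      rcases hx with rfl | rfl | rfl <;> simp [*]
    rw [monomialValue_add_smul_complementVec, monomialValue_add_smul_complementVec, if_pos hx]
    split_ifs with hy
    · rcases hy with rfl | rfl | rfl <;> simp [*]
    · have := hb y
      linarith
  exact ⟨b, key i (by simp), key j (by simp), key k (by simp)⟩

theorem tripleCone_subset_ker {n : ℕ} (i j k : Fin (n + 1)) :
    tripleCone i j k ⊆ LinearMap.ker (tripleForm i j k) := by
  rintro a ⟨b, hi, hj, hk⟩
  exact mem_ker_tripleForm (monomialValue_eq_of_mem_minMonomials hi hj)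
    (monomialValue_eq_of_mem_minMonomials hk hj)

theorem zero_mem_tripleCone {n : ℕ} (i j k : Fin (n + 1)) :
    (0 : Fin (n + 1) → ℝ) ∈ tripleCone i j k :=
  ⟨0, by simp [minMonomials, monomialValue]⟩

/-- Adding the same large multiple of `complementVec` to a vector of the hyperplane and to `0` moves
both into the cone; their difference is unchanged. -/
theorem vectorSpan_tripleCone {n : ℕ} {i j k : Fin (n + 1)} (hij : i ≠ j) (hjk : j ≠ k) :
    vectorSpan ℝ (tripleCone i j k) = LinearMap.ker (tripleForm i j k) := by
  apply le_antisymm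
  · refine vectorSpan_le_ker_of_forall_sub fun a ha q hq => ?_
    rw [LinearMap.mem_ker.1 (tripleCone_subset_ker i j k ha),
      LinearMap.mem_ker.1 (tripleCone_subset_ker i j k hq)]
  · intro a ha
    obtain ⟨t₁, h1⟩ := exists_add_smul_mem_tripleCone hij hjk ha
    obtain ⟨t₂, h2⟩ := exists_add_smul_mem_tripleCone hij hjk (Submodule.zero_mem _)
    have := vsub_mem_vectorSpan ℝ (h1 (max t₁ t₂) (le_max_left _ _))
      (h2 (max t₁ t₂) (le_max_right _ _))
    simpa using this

theorem tripleForm_ne_zero {n : ℕ} {i j k : Fin (n + 1)} (hij : i ≠ j) (hik : i ≠ k)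
    (hjk : j ≠ k) : tripleForm i j k ≠ 0 :=
  slopeForm_ne_zero hij hjk.symm hik hij

theorem isTopCell_tripleCone {n : ℕ} {i j k : Fin (n + 1)} (hij : i ≠ j) (hik : i ≠ k)
    (hjk : j ≠ k) : IsTopCell (tripleCone i j k) :=
  ⟨⟨0, zero_mem_tripleCone i j k⟩, convex_tripleCone i j k, by
    rw [vectorSpan_tripleCone hij hjk]
    exact finrank_ker_of_ne_zero (tripleForm_ne_zero hij hik hjk)⟩

theorem IsTopCell.vectorSpan_eq_of_subset {n : ℕ} {P Q : Set (Fin (n + 1) → ℝ)}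
    (hP : IsTopCell P) (hQ : IsTopCell Q) (h : P ⊆ Q) : vectorSpan ℝ Q = vectorSpan ℝ P :=
  (Submodule.eq_of_le_of_finrank_eq (vectorSpan_mono ℝ h) (hP.2.2.trans hQ.2.2.symm)).symm

theorem IsTopCell.subset_ker_of_subset {n : ℕ} {P Q : Set (Fin (n + 1) → ℝ)} (hP : IsTopCell P)
    (hQ : IsTopCell Q) (h : P ⊆ Q) {l : (Fin (n + 1) → ℝ) →ₗ[ℝ] ℝ}
    (hl : P ⊆ LinearMap.ker l) : Q ⊆ LinearMap.ker l := by
  obtain ⟨a, ha⟩ := hP.1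
  intro q hq
  have h1 := vsub_mem_vectorSpan ℝ hq (h ha)
  rw [hP.vectorSpan_eq_of_subset hQ h] at h1
  have h2 := vectorSpan_le_ker_of_forall_sub (P := P) (l := l) (fun x hx y hy => by
    rw [LinearMap.mem_ker.1 (hl hx), LinearMap.mem_ker.1 (hl hy)]) h1
  simpa using Submodule.add_mem _ h2 (hl ha)

/-- A pair whose minimum is attained at three incongruent monomials satisfies all circuits. -/
theorem mem_circuitLocus_of_mem_minMonomials {p n : ℕ} {E : Fin (n + 1) → Fin (n + 1) → Prop}
    (hE : ∀ i j : Fin (n + 1), ¬ (i : ℕ) ≡ j [MOD p] → E i j)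
    {i j k : Fin (n + 1)} (hij : ¬ (i : ℕ) ≡ j [MOD p]) (hik : ¬ (i : ℕ) ≡ k [MOD p])
    (hjk : ¬ (j : ℕ) ≡ k [MOD p]) {a : Fin (n + 1) → ℝ} {b : ℝ} (hi : i ∈ minMonomials a b)
    (hj : j ∈ minMonomials a b) (hk : k ∈ minMonomials a b) :
    (a, b) ∈ circuitLocus E (indexVal p) := by
  intro l
  have key : ∀ x y : Fin (n + 1), ¬ (x : ℕ) ≡ y [MOD p] → x ∈ minMonomials a b →
      y ∈ minMonomials a b → ¬ (x : ℕ) ≡ l [MOD p] → ¬ (y : ℕ) ≡ l [MOD p] →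
      ∃ x y, x ≠ y ∧ E x l ∧ E y l ∧ ∀ i, E i l →
        monomialValue a b x + indexVal p x l ≤ monomialValue a b i + indexVal p i l ∧
        monomialValue a b y + indexVal p y l ≤ monomialValue a b i + indexVal p i l := by
    intro x y hxy hx hy hxl hyl
    refine ⟨x, y, fun e => hxy (e ▸ rfl), hE x l hxl, hE y l hyl, fun i _ => ?_⟩
    have h1 := hx i
    have h2 := hy i
    have h3 : (0 : ℝ) ≤ indexVal p i l := by positivity
    rw [indexVal_eq_zero hxl, indexVal_eq_zero hyl]
    simp only [Nat.cast_zero]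
    constructor <;> linarith
  -- At most one of `i`, `j`, `k` is congruent to `l`; the other two attain the minimum of the
  -- circuit.
  by_cases hil : (i : ℕ) ≡ l [MOD p]
  · exact key j k hjk hj hk (fun h => hij (hil.trans h.symm)) fun h => hik (hil.trans h.symm)
  · by_cases hjl : (j : ℕ) ≡ l [MOD p]
    · exact key i k hik hi hk hil fun h => hjk (hjl.trans h.symm)
    · exact key i j hij hi hj hil hjl

/-! ### Cells in the gap region -/

/-- If `i ≡ j`, the circuit of `i` ties two monomials `s ≠ t` outside `{i, j}`. By
`IsTopCell.ties_eq` both lie in `{i, j, k}`, so both equal `k`. -/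
theorem not_modEq_of_generic {p n : ℕ} {P : Set (Fin (n + 1) → ℝ)} (hP : IsTopCell P)
    {a : Fin (n + 1) → ℝ} (ha : IsTieGeneric P a) {b : ℝ} {i j k : Fin (n + 1)} (hij : i ≠ j)
    (hik : i ≠ k) (hjk : j ≠ k) (hi : i ∈ minMonomials a b) (hj : j ∈ minMonomials a b)
    (hk : k ∈ minMonomials a b) (h : (a, b) ∈ charLocus p n) : ¬ (i : ℕ) ≡ j [MOD p] := by
  intro hc
  obtain ⟨s, t, hst, hs, ht, he, -⟩ := exists_of_mem_charLocus h i
  have hsi : s ≠ i := fun e => hs (e ▸ rfl)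
  have hti : t ≠ i := fun e => ht (e ▸ rfl)
  have hsj : s ≠ j := fun e => hs (e ▸ hc.symm)
  have htj : t ≠ j := fun e => ht (e ▸ hc.symm)
  have e := hP.ties_eq ha (tied_of_mem_minMonomials hij hi hj) (tied_of_eq hst he) hsi.symm
    hti.symm (tied_of_mem_minMonomials hij hi hj) (tied_of_mem_minMonomials hjk.symm hk hj) hik hij
  have h1 : s ∈ ({i, j, s, t} : Finset (Fin (n + 1))) := by simp
  have h2 : t ∈ ({i, j, s, t} : Finset (Fin (n + 1))) := by simp
  rw [e] at h1 h2
  simp [hsi, hsj] at h1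
  simp [hti, htj] at h2
  exact hst (h1.trans h2.symm)

/-- Shifts are at most `n`, so with a larger gap a circuit containing a minimal monomial attains its
minimum only at minimal monomials. Two such circuits yield three of them. -/
theorem exists_triple_of_padic_gap {p n : ℕ} (hp : p.Prime) {a : Fin (n + 1) → ℝ} {b M : ℝ}
    (hM : (n : ℝ) < M) (h : (a, b) ∈ padicLocus p n)
    (hgap : ∀ i ∈ minMonomials a b, ∀ j ∉ minMonomials a b,
      monomialValue a b i + M ≤ monomialValue a b j) :
    ∃ i ∈ minMonomials a b, ∃ j ∈ minMonomials a b, ∃ k ∈ minMonomials a b,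
      i ≠ j ∧ i ≠ k ∧ j ≠ k := by
  have main : ∀ j, ∀ m ∈ minMonomials a b, m ≠ j → ∃ x ∈ minMonomials a b,
      ∃ y ∈ minMonomials a b, x ≠ y ∧ x ≠ j ∧ y ≠ j := by
    intro j m hm hmj
    obtain ⟨x, y, hxy, hx, hy, he, hmin⟩ := exists_of_mem_padicLocus hp h j
    have h1 := hmin m hmj
    have h2 : (indexVal p m j : ℝ) ≤ n := by exact_mod_cast indexVal_le hp m j
    have h3 : (0 : ℝ) ≤ indexVal p x j := by positivity
    have h4 : (0 : ℝ) ≤ indexVal p y j := by positivity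
    refine ⟨x, ?_, y, ?_, hxy.1, hx, hy⟩
    · by_contra hx'
      have := hgap m hm x hx'
      linarith
    · by_contra hy'
      have := hgap m hm y hy'
      linarith
  obtain ⟨m, hm⟩ := minMonomials_nonempty a b
  obtain ⟨j, -, -, hj, -⟩ := exists_of_mem_padicLocus hp h m
  obtain ⟨x, hx, y, hy, hxy, -, -⟩ := main j m hm hj.symm
  obtain ⟨z, hz, w, hw, hzw, hzx, hwx⟩ := main x y hy hxy.symm
  exact ⟨x, hx, z, hz, w, hw, hzx.symm, hwx.symm, hzw⟩

/-- The circuits in characteristic `p` alone allow two minimal monomials `l`, `m` and a tie `s`, `t`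
far above. But `a` also has a `p`-adic double root `b'`, where by `IsTopCell.ties_eq` the same four
monomials lie in a window of length `n`. Then `b` and `b'` are within `n`, so at `b` the value of
`s` exceeds that of `l` by at most `n + n * n`. -/
theorem exists_triple_of_char_gap {p n : ℕ} (hp : p.Prime) {P : Set (Fin (n + 1) → ℝ)}
    (hP : IsTopCell P) {a : Fin (n + 1) → ℝ} (ha : IsTieGeneric P a) {b b' M : ℝ}
    (hM : (n : ℝ) + n * n < M) (h : (a, b) ∈ charLocus p n)
    (hgap : ∀ i ∈ minMonomials a b, ∀ j ∉ minMonomials a b,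
      monomialValue a b i + M ≤ monomialValue a b j) (h' : (a, b') ∈ padicLocus p n) :
    ∃ i ∈ minMonomials a b, ∃ j ∈ minMonomials a b, ∃ k ∈ minMonomials a b,
      i ≠ j ∧ i ≠ k ∧ j ≠ k := by
  rcases charLocus_dichotomy h with h3 | ⟨l, hl, m, hm, s, t, hlm, hst, hls, hlt, hms, hmt, he⟩
  · exact h3
  by_cases hs : s ∈ minMonomials a b
  · exact ⟨l, hl, m, hm, s, hs, hlm, hls, hms⟩
  exfalso
  have hgs := hgap l hl s hs
  obtain ⟨x, y, z, w, hxy, hzw, hxz, hxw, c, hc⟩ := exists_close_ties_of_mem_padicLocus hp h'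
  rw [hP.ties_eq ha hxy hzw hxz hxw (tied_of_mem_minMonomials hlm hl hm) (tied_of_eq hst he)
    hls hlt] at hc
  have hcl := hc l (by simp)
  have hcm := hc m (by simp)
  have hcs := hc s (by simp)
  have elm := monomialValue_eq_of_mem_minMonomials hl hm
  have hlm1 : (1 : ℝ) ≤ |((l : ℕ) : ℝ) - (m : ℕ)| := by
    have : (1 : ℤ) ≤ |((l : ℕ) : ℤ) - (m : ℕ)| := by
      apply Int.one_le_abs
      have := Fin.val_ne_of_ne hlm
      omega
    exact_mod_cast this
  -- The values of `l` and `m` agree at `b` and differ by at most `n` at `b'`, and their slopes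
  -- differ by at least `1`.
  have hb : |b' - b| ≤ n := by
    have e : (((l : ℕ) : ℝ) - (m : ℕ)) * (b' - b) =
        monomialValue a b' l - monomialValue a b' m := by
      simp only [monomialValue] at elm ⊢
      linarith
    have h1 : |(((l : ℕ) : ℝ) - (m : ℕ)) * (b' - b)| ≤ n := by
      rw [e, abs_le]
      constructor <;> linarith
    rw [abs_mul] at h1
    have := mul_le_mul_of_nonneg_right hlm1 (abs_nonneg (b' - b))
    linarith
  have hsl : |((l : ℕ) : ℝ) - (s : ℕ)| ≤ n := by
    have h1 : ((l : ℕ) : ℝ) ≤ n := by exact_mod_cast Fin.is_le l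
    have h2 : ((s : ℕ) : ℝ) ≤ n := by exact_mod_cast Fin.is_le s
    have h3 : (0 : ℝ) ≤ (l : ℕ) := by positivity
    have h4 : (0 : ℝ) ≤ (s : ℕ) := by positivity
    rw [abs_le]
    constructor <;> linarith
  have hprod : (((l : ℕ) : ℝ) - (s : ℕ)) * (b' - b) ≤ n * n := by
    refine (le_abs_self _).trans ?_
    rw [abs_mul]
    exact mul_le_mul hsl hb (abs_nonneg _) (by positivity)
  have e : monomialValue a b s - monomialValue a b l =
      monomialValue a b' s - monomialValue a b' l + (((l : ℕ) : ℝ) - (s : ℕ)) * (b' - b) := by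
    simp only [monomialValue]
    ring
  linarith

theorem exists_tripleCone_superset {p n : ℕ} (hp : p.Prime) {P : Set (Fin (n + 1) → ℝ)}
    (hP : IsTopCell P) {M : ℝ} (hM : (n : ℝ) + n * n < M) {S : Set ((Fin (n + 1) → ℝ) × ℝ)}
    (hS : S = padicLocus p n ∨ S = charLocus p n) (hv : P ⊆ Prod.fst '' padicLocus p n)
    (hw : P ⊆ Prod.fst '' charLocus p n) (hg : P ⊆ gapRegion S M) :
    ∃ i j k : Fin (n + 1), ¬ (i : ℕ) ≡ j [MOD p] ∧ ¬ (i : ℕ) ≡ k [MOD p] ∧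
      ¬ (j : ℕ) ≡ k [MOD p] ∧ P ⊆ tripleCone i j k := by
  obtain ⟨a, ha⟩ := hP.exists_isTieGeneric
  obtain ⟨b, hb, hgap⟩ := hg ha.1
  obtain ⟨⟨_, bv⟩, hbv, rfl⟩ := hv ha.1
  obtain ⟨⟨a, bw⟩, hbw, rfl⟩ := hw ha.1
  dsimp only at *
  have hn : (n : ℝ) < M := by nlinarith [(Nat.cast_nonneg n : (0 : ℝ) ≤ n)]
  obtain ⟨i, hi, j, hj, k, hk, hij, hik, hjk⟩ : ∃ i ∈ minMonomials a b, ∃ j ∈ minMonomials a b,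
      ∃ k ∈ minMonomials a b, i ≠ j ∧ i ≠ k ∧ j ≠ k := by
    rcases hS with rfl | rfl
    · exact exists_triple_of_padic_gap hp hn hb hgap
    · exact exists_triple_of_char_gap hp hP ha hM hb hgap hbv
  have tij := tied_of_mem_minMonomials hij hi hj
  have tkj := tied_of_mem_minMonomials hjk.symm hk hj
  -- The root `b` may be `p`-adic; the triple is passed to the root `bw` of characteristic `p`,
  -- where incongruence can be deduced.
  obtain ⟨hi', hj', hk'⟩ := mem_minMonomials_of_charLocus hP ha hik tij tkj hbw
  refine ⟨i, j, k, not_modEq_of_generic hP ha hij hik hjk hi' hj' hk' hbw,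
    not_modEq_of_generic hP ha hik hij hjk.symm hi' hk' hj' hbw,
    not_modEq_of_generic hP ha hjk hij.symm hik.symm hj' hk' hi' hbw, ?_⟩
  refine subset_tripleCone_of_subset_charLocus hP hij hik hjk (fun q hq => ?_) hw
  have h0 : slopeDefect i j k j ((0 : ℤ) : ℝ) ((0 : ℤ) : ℝ) a = 0 := by
    have := tripleCone_subset_ker i j k ⟨b, hi, hj, hk⟩
    rw [SetLike.mem_coe, LinearMap.mem_ker, tripleForm, slopeForm_apply] at this
    simpa using this
  have := ha.2 i j k j 0 (by simp) 0 (by simp) h0 q hq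
  rw [SetLike.mem_coe, LinearMap.mem_ker, tripleForm, slopeForm_apply]
  simpa using this

open Pointwise in
-- Translating the cone by `M • complementVec i j k` keeps it inside itself and raises every
-- monomial outside the triple by `M`.
theorem exists_isTopCell_gapRegion {p n : ℕ} {S : Set ((Fin (n + 1) → ℝ) × ℝ)}
    (hS : S = padicLocus p n ∨ S = charLocus p n) {M : ℝ} (hM : 0 < M) {i j k : Fin (n + 1)}
    (hij : ¬ (i : ℕ) ≡ j [MOD p]) (hik : ¬ (i : ℕ) ≡ k [MOD p]) (hjk : ¬ (j : ℕ) ≡ k [MOD p]) :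
    ∃ P, IsTopCell P ∧ P ⊆ tripleCone i j k ∩ gapRegion S M := by
  have hC := isTopCell_tripleCone (fun e : i = j => hij (e ▸ rfl))
    (fun e : i = k => hik (e ▸ rfl)) fun e : j = k => hjk (e ▸ rfl)
  refine ⟨M • complementVec i j k +ᵥ tripleCone i j k, ⟨hC.1.vadd_set, hC.2.1.vadd _, ?_⟩, ?_⟩
  · rw [vectorSpan_vadd]
    exact hC.2.2
  · rintro _ ⟨a, ⟨b, hi, hj, hk⟩, rfl⟩
    simp only [vadd_eq_add]
    rw [add_comm (M • _) a]
    have hij' := monomialValue_eq_of_mem_minMonomials hi hj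
    have hik' := monomialValue_eq_of_mem_minMonomials hi hk
    have mem : ∀ x, x = i ∨ x = j ∨ x = k → x ∈ minMonomials (a + M • complementVec i j k) b := by
      intro x hx y
      have hx' : x ∈ minMonomials a b := by rcases hx with rfl | rfl | rfl <;> assumption
      rw [monomialValue_add_smul_complementVec, monomialValue_add_smul_complementVec, if_pos hx]
      have := hx' y
      split_ifs <;> linarith
    refine ⟨⟨b, mem i (by simp), mem j (by simp), mem k (by simp)⟩, b, ?_, ?_⟩
    · rcases hS with rfl | rfl
      · exact mem_circuitLocus_of_mem_minMonomials
          (fun x y h (e : x = y) => h (e ▸ rfl)) hij hik hjk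
          (mem i (by simp)) (mem j (by simp)) (mem k (by simp))
      · exact mem_circuitLocus_of_mem_minMonomials (fun x y h => h) hij hik hjk
          (mem i (by simp)) (mem j (by simp)) (mem k (by simp))
    · intro x hx y hy
      have hy' : ¬ (y = i ∨ y = j ∨ y = k) := fun h => hy (mem y h)
      refine (add_le_add_left (hx i) M).trans ?_
      rw [monomialValue_add_smul_complementVec, monomialValue_add_smul_complementVec,
        if_pos (by simp), if_neg hy']
      have := hi y
      linarith

theorem setOf_isMaximalCell_eq_typeICones {p n : ℕ} (hp : p.Prime) {M : ℝ}
    (hM : (n : ℝ) + n * n < M) {S : Set ((Fin (n + 1) → ℝ) × ℝ)}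
    (hS : S = padicLocus p n ∨ S = charLocus p n) :
    {C : Set (Fin (n + 1) → ℝ) | IsMaximalCell (Prod.fst '' padicLocus p n) C ∧
      IsMaximalCell (Prod.fst '' charLocus p n) C ∧
      ∃ P, IsTopCell P ∧ P ⊆ C ∩ gapRegion S M} = typeICones p n := by
  have hM0 : 0 < M := by nlinarith [(Nat.cast_nonneg n : (0 : ℝ) ≤ n)]
  have sub : ∀ {i j k : Fin (n + 1)}, ¬ (i : ℕ) ≡ j [MOD p] → ¬ (i : ℕ) ≡ k [MOD p] →
      ¬ (j : ℕ) ≡ k [MOD p] → tripleCone i j k ⊆ Prod.fst '' padicLocus p n ∧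
        tripleCone i j k ⊆ Prod.fst '' charLocus p n := by
    intro i j k hij hik hjk
    constructor
    · rintro a ⟨b, hi, hj, hk⟩
      exact ⟨(a, b), mem_circuitLocus_of_mem_minMonomials
          (fun x y h (e : x = y) => h (e ▸ rfl))
        hij hik hjk hi hj hk, rfl⟩
    · rintro a ⟨b, hi, hj, hk⟩
      exact ⟨(a, b), mem_circuitLocus_of_mem_minMonomials (fun x y h => h)
        hij hik hjk hi hj hk, rfl⟩
  ext C
  constructor
  · rintro ⟨hCv, hCw, P, hP, hPC⟩
    have hPC' : P ⊆ C := fun a ha => (hPC ha).1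
    obtain ⟨i, j, k, hij, hik, hjk, hPT⟩ := exists_tripleCone_superset hp hP hM hS
      (hPC'.trans hCv.1.2) (hPC'.trans hCw.1.2) fun a ha => (hPC ha).2
    have hij' : i ≠ j := fun e => hij (e ▸ rfl)
    have hik' : i ≠ k := fun e => hik (e ▸ rfl)
    have hjk' : j ≠ k := fun e => hjk (e ▸ rfl)
    -- `C` has the same directions as `P`, so it lies in the hyperplane of the triple, hence in the
    -- cone; maximality of `C` gives equality.
    have hCk := hP.subset_ker_of_subset hCw.1.1 hPC' (hPT.trans (tripleCone_subset_ker i j k))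
    exact ⟨i, j, k, hij, hik, hjk, hCw.eq_of_subset
      ⟨isTopCell_tripleCone hij' hik' hjk', (sub hij hik hjk).2⟩
      (subset_tripleCone_of_subset_charLocus hCw.1.1 hij' hik' hjk' hCk hCw.1.2)⟩
  · rintro ⟨i, j, k, hij, hik, hjk, rfl⟩
    have hij' : i ≠ j := fun e => hij (e ▸ rfl)
    have hik' : i ≠ k := fun e => hik (e ▸ rfl)
    have hjk' : j ≠ k := fun e => hjk (e ▸ rfl)
    have hT := isTopCell_tripleCone hij' hik' hjk'
    refine ⟨⟨⟨hT, (sub hij hik hjk).1⟩, fun Q hQ h => ?_⟩,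
      ⟨⟨hT, (sub hij hik hjk).2⟩, fun Q hQ h => ?_⟩,
      exists_isTopCell_gapRegion hS hM0 hij hik hjk⟩
    · exact subset_tripleCone_of_subset_padicLocus hp hQ.1 hij hik hjk
        (hT.subset_ker_of_subset hQ.1 h (tripleCone_subset_ker i j k)) hQ.2
    · exact subset_tripleCone_of_subset_charLocus hQ.1 hij' hik' hjk'
        (hT.subset_ker_of_subset hQ.1 h (tripleCone_subset_ker i j k)) hQ.2

/-! ### Real valuations and integers -/

namespace AddValuation

variable {K : Type*} [Field K] (v : AddValuation K (WithTop ℝ))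

theorem exists_eq_coe {x : K} (hx : x ≠ 0) : ∃ r : ℝ, v x = (r : WithTop ℝ) := by
  have : v x ≠ ⊤ := fun h => hx (v.top_iff.1 h)
  exact ⟨(v x).untop this, (WithTop.coe_untop _ _).symm⟩

theorem ne_zero_of_eq_coe {x : K} {r : ℝ} (h : v x = (r : WithTop ℝ)) : x ≠ 0 := fun h0 =>
  WithTop.coe_ne_top (h.symm.trans (v.top_iff.2 h0))

theorem map_inv_of_eq_coe {x : K} {r : ℝ} (h : v x = (r : WithTop ℝ)) :
    v x⁻¹ = ((-r : ℝ) : WithTop ℝ) := by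
  have h0 := v.ne_zero_of_eq_coe h
  obtain ⟨s, hs⟩ := v.exists_eq_coe (inv_ne_zero h0)
  have h1 : v (x * x⁻¹) = ((r + s : ℝ) : WithTop ℝ) := by rw [v.map_mul, h, hs]; rfl
  rw [mul_inv_cancel₀ h0, v.map_one] at h1
  have h2 : (0 : ℝ) = r + s := WithTop.coe_injective h1
  rw [hs, show s = -r by linarith]

theorem map_pow_of_eq_coe {x : K} {r : ℝ} (h : v x = (r : WithTop ℝ)) (m : ℕ) :
    v (x ^ m) = ((m * r : ℝ) : WithTop ℝ) := by
  induction m with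
  | zero => simp
  | succ m ih =>
    rw [pow_succ, v.map_mul, ih, h, ← WithTop.coe_add, Nat.cast_succ, add_one_mul]

/-- The value group. -/
def valueGroup : AddSubgroup ℝ where
  carrier := {r | ∃ x, v x = (r : WithTop ℝ)}
  add_mem' := by
    rintro r s ⟨x, hx⟩ ⟨y, hy⟩
    exact ⟨x * y, by rw [v.map_mul, hx, hy]; rfl⟩
  zero_mem' := ⟨1, v.map_one⟩
  neg_mem' := by
    rintro r ⟨x, hx⟩
    exact ⟨x⁻¹, v.map_inv_of_eq_coe hx⟩

theorem dense_valueGroup [IsAlgClosed K] (h : ∃ x : K, x ≠ 0 ∧ v x ≠ 0) :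
    Dense (v.valueGroup : Set ℝ) := by
  obtain ⟨x, hx, hvx⟩ := h
  obtain ⟨r, hr⟩ := v.exists_eq_coe hx
  have hr0 : r ≠ 0 := by
    rintro rfl
    exact hvx hr
  obtain ⟨s, hs, y, hy⟩ : ∃ s : ℝ, 0 < s ∧ s ∈ v.valueGroup := by
    rcases lt_or_gt_of_ne hr0 with h | h
    · exact ⟨-r, by linarith, v.valueGroup.neg_mem ⟨x, hr⟩⟩
    · exact ⟨r, h, x, hr⟩
  refine AddSubgroup.dense_of_not_isolated_zero _ fun ε hε => ?_
  -- An `m`-th root of an element of value `s` has value `s / m < ε`.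
  obtain ⟨m, hm⟩ := exists_nat_gt (s / ε)
  have hm0 : (0 : ℝ) < m := (div_pos hs hε).trans hm
  obtain ⟨z, hz⟩ := IsAlgClosed.exists_pow_nat_eq y (n := m) (by exact_mod_cast hm0)
  have hz0 : z ≠ 0 := by
    rintro rfl
    rw [zero_pow (by rintro rfl; simp at hm0)] at hz
    exact v.ne_zero_of_eq_coe hy hz.symm
  obtain ⟨t, ht⟩ := v.exists_eq_coe hz0
  have h1 := v.map_pow_of_eq_coe ht m
  rw [hz, hy] at h1
  have h2 : s = m * t := WithTop.coe_injective h1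
  have ht2 : t = s / m := by field_simp; linarith
  refine ⟨t, ⟨z, ht⟩, ?_, ?_⟩
  · rw [ht2]; positivity
  · rw [ht2, div_lt_iff₀ hm0]
    rw [div_lt_iff₀ hε] at hm
    linarith

theorem map_sum_eq_of_forall_lt {ι : Type*} {s : Finset ι} {f : ι → K} {i : ι} (hi : i ∈ s)
    (h0 : f i ≠ 0) (h : ∀ j ∈ s, j ≠ i → v (f i) < v (f j)) : v (∑ j ∈ s, f j) = v (f i) := by
  classical
  rw [← Finset.add_sum_erase s f hi]
  apply v.map_add_eq_of_lt_left
  refine v.map_lt_sum (fun h => h0 (v.top_iff.1 h)) fun j hj => ?_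
  exact h j (Finset.mem_of_mem_erase hj) (Finset.ne_of_mem_erase hj)

/-- The minimal valuation of the terms of a vanishing sum is attained twice. -/
theorem exists_ne_of_sum_eq_zero {ι : Type*} [Fintype ι] {f : ι → K} (h : ∑ i, f i = 0)
    (h0 : ∃ i, f i ≠ 0) : ∃ x y, x ≠ y ∧ f x ≠ 0 ∧ f y ≠ 0 ∧
      ∀ i, v (f x) ≤ v (f i) ∧ v (f y) ≤ v (f i) := by
  obtain ⟨i₀, hi₀⟩ := h0
  have : Nonempty ι := ⟨i₀⟩
  obtain ⟨x, hx⟩ := Finite.exists_min fun i => v (f i)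
  have hx0 : f x ≠ 0 := by
    intro hx0
    have := hx i₀
    rw [hx0, v.map_zero, top_le_iff] at this
    exact hi₀ (v.top_iff.1 this)
  obtain ⟨y, hyx, hy⟩ : ∃ y, y ≠ x ∧ v (f y) ≤ v (f x) := by
    by_contra! hc
    have := v.map_sum_eq_of_forall_lt (Finset.mem_univ x) hx0 fun j _ hj => hc j hj
    rw [h, v.map_zero] at this
    exact hx0 (v.top_iff.1 this.symm)
  refine ⟨x, y, hyx.symm, hx0, ?_, fun i => ⟨hx i, hy.trans (hx i)⟩⟩
  intro hy0
  rw [hy0, v.map_zero, top_le_iff] at hy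
  exact hx0 (v.top_iff.1 hy)

theorem map_eq_of_map_mul_eq {x y : K} {r d : ℝ} (h : v (x * y) = (r : WithTop ℝ))
    (hy : v y = (d : WithTop ℝ)) : v x = ((r - d : ℝ) : WithTop ℝ) := by
  have h0 := v.ne_zero_of_eq_coe h
  obtain ⟨s, hs⟩ := v.exists_eq_coe (left_ne_zero_of_mul h0)
  rw [v.map_mul, hs, hy] at h
  have : s + d = r := WithTop.coe_injective h
  rw [hs, show s = r - d by linarith]

theorem map_natCast_nonneg (m : ℕ) : 0 ≤ v (m : K) := by
  induction m with
  | zero => simp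
  | succ m ih =>
    rw [Nat.cast_succ]
    exact v.map_le_add ih v.map_one.ge

theorem map_intCast_nonneg (z : ℤ) : 0 ≤ v (z : K) := by
  obtain ⟨m, rfl | rfl⟩ := z.eq_nat_or_neg
  · simpa using v.map_natCast_nonneg m
  · simpa [v.map_neg] using v.map_natCast_nonneg m

/-- By Bézout, `s * z + t * p = 1`, so `z` and `p` cannot both have positive valuation. This
includes characteristic `p`, where `v p = ⊤`. -/
theorem map_intCast_eq_zero {p : ℕ} (hp : p.Prime) (hv : 0 < v (p : K)) {z : ℤ}
    (hz : ¬ (p : ℤ) ∣ z) : v (z : K) = 0 := by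
  refine le_antisymm (not_lt.1 fun hpos => ?_) (v.map_intCast_nonneg z)
  obtain ⟨s, t, hst⟩ := ((Nat.prime_iff_prime_int.1 hp).coprime_iff_not_dvd.2 hz).symm
  have h1 : (0 : WithTop ℝ) < v ((s : K) * z + t * p) := by
    refine v.map_lt_add ?_ ?_
    · rw [v.map_mul]
      exact hpos.trans_le (le_add_of_nonneg_left (v.map_intCast_nonneg s))
    · rw [v.map_mul]
      exact hv.trans_le (le_add_of_nonneg_left (v.map_intCast_nonneg t))
  have h2 : (s : K) * z + t * p = 1 := by exact_mod_cast congrArg (Int.cast : ℤ → K) hst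
  rw [h2, v.map_one] at h1
  exact lt_irrefl _ h1

theorem map_intCast_eq_padicValInt {p : ℕ} (hp : p.Prime) (hv : v (p : K) = ((1 : ℝ) : WithTop ℝ))
    {z : ℤ} (hz : z ≠ 0) : v (z : K) = ((padicValInt p z : ℝ) : WithTop ℝ) := by
  have hfin : FiniteMultiplicity (p : ℤ) z :=
    Int.finiteMultiplicity_iff.2 ⟨by simpa using hp.one_lt.ne', hz⟩
  obtain ⟨c, hc, hpc⟩ := hfin.exists_eq_pow_mul_and_not_dvd
  have hpos : 0 < v (p : K) := by
    rw [hv]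
    exact_mod_cast one_pos
  rw [padicValInt.of_ne_one_ne_zero hp.ne_one hz]
  conv_lhs => rw [hc]
  push_cast
  rw [v.map_mul, v.map_intCast_eq_zero hp hpos hpc, v.map_pow_of_eq_coe hv, add_zero, mul_one]
  exact WithTop.coe_natCast _

end AddValuation

/-! ### Lifting solutions of the circuits -/

/-- The substitution `c i = A i * B ^ i` moves the double root to `1` and makes the conditions
linear in `c`. -/
theorem mem_liftedPairs_iff {K : Type*} [Field K] (v : AddValuation K (WithTop ℝ)) (n : ℕ)
    (q : (Fin (n + 1) → ℝ) × ℝ) :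
    q ∈ liftedPairs v n ↔ ∃ (c : Fin (n + 1) → K) (B : K),
      (∀ i, v (c i) = ((monomialValue q.1 q.2 i : ℝ) : WithTop ℝ)) ∧
      v B = ((q.2 : ℝ) : WithTop ℝ) ∧ ∑ i, c i = 0 ∧ ∑ i : Fin (n + 1), ((i : ℕ) : K) * c i = 0 := by
  have hder : ∀ (F : K[X]) (B : K), F.natDegree = n →
      ∑ i : Fin (n + 1), ((i : ℕ) : K) * (F.coeff i * B ^ (i : ℕ)) = B * F.derivative.eval B := by
    intro F B hF
    rw [derivative_eval, sum_over_range' _ (by simp) (n + 1) (by omega), Finset.mul_sum,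
      Fin.sum_univ_eq_sum_range (fun i => (i : K) * (F.coeff i * B ^ i)) (n + 1)]
    refine Finset.sum_congr rfl fun i _ => ?_
    cases i with
    | zero => simp
    | succ i =>
      rw [Nat.add_sub_cancel]
      ring
  have hev : ∀ (F : K[X]) (B : K), F.natDegree = n →
      ∑ i : Fin (n + 1), F.coeff i * B ^ (i : ℕ) = F.eval B := by
    intro F B hF
    rw [eval_eq_sum_range, hF, Fin.sum_univ_eq_sum_range (fun i => F.coeff i * B ^ i) (n + 1)]
  constructor
  · rintro ⟨F, B, hF, hA, hB, h0, h1⟩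
    refine ⟨fun i => F.coeff i * B ^ (i : ℕ), B, fun i => ?_, hB, ?_, ?_⟩
    · rw [v.map_mul, hA, v.map_pow_of_eq_coe hB]
      rfl
    · rw [hev F B hF, h0]
    · rw [hder F B hF, h1, mul_zero]
  · rintro ⟨c, B, hc, hB, h0, h1⟩
    have hB0 := v.ne_zero_of_eq_coe hB
    let F : K[X] := ∑ i : Fin (n + 1), monomial (i : ℕ) (c i * B⁻¹ ^ (i : ℕ))
    have hcoeff : ∀ i : Fin (n + 1), F.coeff i = c i * B⁻¹ ^ (i : ℕ) := by
      intro i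
      simp only [F, finsetSum_coeff, coeff_monomial]
      rw [Finset.sum_eq_single i]
      · simp
      · intro j _ hj
        rw [if_neg (Fin.val_ne_of_ne hj)]
      · simp
    have hval : ∀ i : Fin (n + 1), v (F.coeff i) = ((q.1 i : ℝ) : WithTop ℝ) := by
      intro i
      rw [hcoeff, v.map_mul, hc, v.map_pow_of_eq_coe (v.map_inv_of_eq_coe hB), ← WithTop.coe_add,
        monomialValue]
      congr 1
      ring
    have hF : F.natDegree = n := by
      refine natDegree_eq_of_le_of_coeff_ne_zero ?_ ?_
      · refine natDegree_sum_le_of_forall_le _ _ fun i _ => ?_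
        exact (natDegree_monomial_le _).trans (Fin.is_le i)
      · have := hval (Fin.last n)
        exact v.ne_zero_of_eq_coe this
    have hterm : ∀ i : Fin (n + 1), F.coeff i * B ^ (i : ℕ) = c i := by
      intro i
      rw [hcoeff, mul_assoc, ← mul_pow, inv_mul_cancel₀ hB0, one_pow, mul_one]
    refine ⟨F, B, hF, hval, hB, ?_, ?_⟩
    · rw [← hev F B hF]
      simpa [hterm] using h0
    · have := hder F B hF
      simp only [hterm] at this
      exact (mul_eq_zero.1 (this.symm.trans h1)).resolve_left hB0

section lifting

variable {K : Type*} [Field K] (v : AddValuation K (WithTop ℝ)) {n : ℕ}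
  {E : Fin (n + 1) → Fin (n + 1) → Prop} {D : Fin (n + 1) → Fin (n + 1) → ℕ}

theorem liftedPairs_subset_circuitLocus
    (hE : ∀ i j : Fin (n + 1), E i j ↔ ((i : ℕ) : K) ≠ ((j : ℕ) : K))
    (hD : ∀ i j : Fin (n + 1), E i j →
      v (((i : ℕ) : K) - ((j : ℕ) : K)) = ((D i j : ℝ) : WithTop ℝ)) :
    liftedPairs v n ⊆ circuitLocus E D := by
  intro q hq j
  obtain ⟨c, B, hc, -, h0, h1⟩ := (mem_liftedPairs_iff v n q).1 hq
  have hsum : ∑ i : Fin (n + 1), (((i : ℕ) : K) - ((j : ℕ) : K)) * c i = 0 := by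
    simp only [sub_mul, Finset.sum_sub_distrib, ← Finset.mul_sum, h0, h1, mul_zero, sub_zero]
  have hc0 : ∀ i, c i ≠ 0 := fun i => v.ne_zero_of_eq_coe (hc i)
  have hne : ∀ i : Fin (n + 1), (((i : ℕ) : K) - ((j : ℕ) : K)) * c i ≠ 0 ↔ E i j := by
    intro i
    rw [mul_ne_zero_iff, sub_ne_zero, hE]
    exact and_iff_left (hc0 i)
  have hterm : ∀ i, E i j → v ((((i : ℕ) : K) - ((j : ℕ) : K)) * c i) =
      ((monomialValue q.1 q.2 i + D i j : ℝ) : WithTop ℝ) := by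
    intro i hi
    rw [v.map_mul, hD i j hi, hc, ← WithTop.coe_add, add_comm]
  -- The circuit is not empty: `n = 0` would force `c 0 = 0`, and for `n ≥ 1` the indices `0` and
  -- `1` differ in `K`.
  have hex : ∃ i, E i j := by
    by_contra! hno
    have hno' : ∀ i : Fin (n + 1), ((i : ℕ) : K) = ((j : ℕ) : K) := by
      intro i
      have := hno i
      rwa [hE, not_not] at this
    rcases Nat.eq_zero_or_pos n with rfl | hn
    · exact hc0 0 (by simpa using h0)
    · have e := (hno' ⟨0, by omega⟩).trans (hno' ⟨1, by omega⟩).symm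
      simp at e
  obtain ⟨i₀, hi₀⟩ := hex
  obtain ⟨x, y, hxy, hx, hy, hm⟩ := v.exists_ne_of_sum_eq_zero hsum ⟨i₀, (hne i₀).2 hi₀⟩
  rw [hne] at hx hy
  refine ⟨x, y, hxy, hx, hy, fun i hi => ?_⟩
  have := hm i
  rw [hterm i hi, hterm x hx, hterm y hy] at this
  exact_mod_cast this

/-- Tropical polynomials without accidental cancellations. -/
def separatedPoints (D : Fin (n + 1) → Fin (n + 1) → ℕ) : Set (Fin (n + 1) → ℝ) :=
  {α | ∀ i i' j : Fin (n + 1), i ≠ i' → α i + D i j ≠ α i' + D i' j}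

theorem isOpen_separatedPoints (D : Fin (n + 1) → Fin (n + 1) → ℕ) :
    IsOpen (separatedPoints D) := by
  simp only [separatedPoints, Set.ofPred_forall]
  refine isOpen_iInter_of_finite fun i => isOpen_iInter_of_finite fun i' =>
    isOpen_iInter_of_finite fun j => isOpen_iInter_of_finite fun _ => ?_
  exact isOpen_ne_fun (by fun_prop) (by fun_prop)

theorem dense_separatedPoints (D : Fin (n + 1) → Fin (n + 1) → ℕ) :
    Dense (separatedPoints D) := by
  let h (t : Fin (n + 1) × Fin (n + 1) × Fin (n + 1)) (α : Fin (n + 1) → ℝ) : ℝ :=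
    (α t.1 + D t.1 t.2.2) - (α t.2.1 + D t.2.1 t.2.2)
  have := (convex_univ (𝕜 := ℝ) (E := Fin (n + 1) → ℝ)).subset_closure_generic h
    (fun t => by unfold h; fun_prop)
    (fun t a q s => by
      simp only [h, Pi.add_apply, Pi.smul_apply, Pi.sub_apply, smul_eq_mul]
      ring) Finset.univ
  intro α
  refine closure_mono ?_ (this (Set.mem_univ α))
  rintro β ⟨-, hβ⟩ i i' j hne he
  have h1 := hβ (i, i', j) (Finset.mem_univ _) (sub_eq_zero.2 he)
    (Pi.single i (1 - D i j + D i' j)) (Set.mem_univ _)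
  simp only [h, Pi.single_eq_same, Pi.single_eq_of_ne hne.symm] at h1
  linarith

/-- At separated points the terms have distinct valuations, so nothing cancels. -/
theorem map_sum_eq_inf'
    (hD : ∀ i j : Fin (n + 1), E i j →
      v (((i : ℕ) : K) - ((j : ℕ) : K)) = ((D i j : ℝ) : WithTop ℝ))
    {α : Fin (n + 1) → ℝ} (hα : α ∈ separatedPoints D) {c : Fin (n + 1) → K}
    (hc : ∀ i, v (c i) = (α i : WithTop ℝ)) {y : Fin (n + 1)} {I : Finset (Fin (n + 1))}
    (hI : I.Nonempty) (hIE : ∀ i ∈ I, E i y) :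
    v (∑ i ∈ I, (((i : ℕ) : K) - ((y : ℕ) : K)) * c i) =
      ((I.inf' hI fun i => α i + D i y : ℝ) : WithTop ℝ) := by
  have hterm : ∀ i ∈ I, v ((((i : ℕ) : K) - ((y : ℕ) : K)) * c i) =
      ((α i + D i y : ℝ) : WithTop ℝ) := by
    intro i hi
    rw [v.map_mul, hD i y (hIE i hi), hc, ← WithTop.coe_add, add_comm]
  obtain ⟨i, hi, he⟩ := Finset.exists_mem_eq_inf' hI fun i => α i + (D i y : ℝ)
  rw [he, ← hterm i hi]
  refine v.map_sum_eq_of_forall_lt hi (v.ne_zero_of_eq_coe (hterm i hi)) fun j hj hji => ?_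
  rw [hterm i hi, hterm j hj]
  have h1 : α i + (D i y : ℝ) ≤ α j + D j y :=
    he ▸ Finset.inf'_le (fun i => α i + (D i y : ℝ)) hj
  exact_mod_cast lt_of_le_of_ne h1 (hα i j y hji.symm)

/-- Solving the two linear equations of a double root at `1` for the coefficients `x` and `y`. -/
theorem exists_coefficients
    (hE : ∀ i j : Fin (n + 1), E i j ↔ ((i : ℕ) : K) ≠ ((j : ℕ) : K))
    (hD : ∀ i j : Fin (n + 1), E i j →
      v (((i : ℕ) : K) - ((j : ℕ) : K)) = ((D i j : ℝ) : WithTop ℝ))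
    {α : Fin (n + 1) → ℝ} (hα : α ∈ separatedPoints D) (hv : ∀ i, α i ∈ v.valueGroup)
    {x y : Fin (n + 1)} (hxy : E x y) (hyx : E y x) {I J : Finset (Fin (n + 1))}
    (hI : I.Nonempty) (hJ : J.Nonempty)
    (hIE : ∀ i, i ∈ I ↔ i ≠ x ∧ E i y) (hJE : ∀ i, i ∈ J ↔ i ≠ y ∧ E i x) :
    ∃ c : Fin (n + 1) → K, ∑ i, c i = 0 ∧ ∑ i : Fin (n + 1), ((i : ℕ) : K) * c i = 0 ∧
      v (c x) = (((I.inf' hI fun i => α i + D i y) - D x y : ℝ) : WithTop ℝ) ∧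
      v (c y) = (((J.inf' hJ fun i => α i + D i x) - D y x : ℝ) : WithTop ℝ) ∧
      ∀ i, i ≠ x → i ≠ y → v (c i) = (α i : WithTop ℝ) := by
  choose c₀ hc₀ using hv
  have hne : x ≠ y := fun e => (hE x y).1 hxy (e ▸ rfl)
  let S (I : Finset (Fin (n + 1))) (y : Fin (n + 1)) : K :=
    ∑ i ∈ I, (((i : ℕ) : K) - ((y : ℕ) : K)) * c₀ i
  -- `c x` is solved from the circuit of `y`, which omits `c y`, and `c y` from the circuit of `x`.
  let c : Fin (n + 1) → K := fun i =>
    if i = x then -S I y / (((x : ℕ) : K) - ((y : ℕ) : K))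
    else if i = y then -S J x / (((y : ℕ) : K) - ((x : ℕ) : K)) else c₀ i
  have hd : ((x : ℕ) : K) - ((y : ℕ) : K) ≠ 0 := sub_ne_zero.2 ((hE x y).1 hxy)
  have hd' : ((y : ℕ) : K) - ((x : ℕ) : K) ≠ 0 := sub_ne_zero.2 ((hE y x).1 hyx)
  have hcx : (((x : ℕ) : K) - ((y : ℕ) : K)) * c x = -S I y := by
    simp only [c, if_true]
    field_simp
  have hcy : (((y : ℕ) : K) - ((x : ℕ) : K)) * c y = -S J x := by
    simp only [c, if_true, hne.symm, if_false]
    field_simp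
  have hci : ∀ i, i ≠ x → i ≠ y → c i = c₀ i := fun i h1 h2 => by simp [c, h1, h2]
  have rest : ∀ (z w : Fin (n + 1)) (I : Finset (Fin (n + 1))), (∀ i, i ∈ I ↔ i ≠ z ∧ E i w) →
      (z = x ∧ w = y ∨ z = y ∧ w = x) → (((z : ℕ) : K) - ((w : ℕ) : K)) * c z = -S I w →
      ∑ i : Fin (n + 1), (((i : ℕ) : K) - ((w : ℕ) : K)) * c i = 0 := by
    intro z w I hI hzw h
    have hz : z ∉ I := by simp [hI]
    have hsub : ∑ i ∈ insert z I, (((i : ℕ) : K) - ((w : ℕ) : K)) * c i =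
        ∑ i : Fin (n + 1), (((i : ℕ) : K) - ((w : ℕ) : K)) * c i := by
      refine Finset.sum_subset (Finset.subset_univ _) fun i _ hi => ?_
      have : ¬ E i w := fun hE' => hi (by
        rw [Finset.mem_insert, hI]
        tauto)
      rw [hE, not_not] at this
      rw [this, sub_self, zero_mul]
    rw [← hsub, Finset.sum_insert hz, h, neg_add_eq_zero]
    refine Finset.sum_congr rfl fun i hi => ?_
    have h1 := (hI i).1 hi
    have h2 : i ≠ w := fun e => (hE i w).1 h1.2 (e ▸ rfl)
    rw [hci]
    · rcases hzw with ⟨rfl, rfl⟩ | ⟨rfl, rfl⟩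
      · exact h1.1
      · exact h2
    · rcases hzw with ⟨rfl, rfl⟩ | ⟨rfl, rfl⟩
      · exact h2
      · exact h1.1
  have s1 := rest x y I hIE (Or.inl ⟨rfl, rfl⟩) hcx
  have s2 := rest y x J hJE (Or.inr ⟨rfl, rfl⟩) hcy
  simp only [sub_mul, Finset.sum_sub_distrib, ← Finset.mul_sum] at s1 s2
  have s0 : ∑ i, c i = 0 := by
    have : (((x : ℕ) : K) - ((y : ℕ) : K)) * ∑ i, c i = 0 := by linear_combination s1 - s2
    exact (mul_eq_zero.1 this).resolve_left hd
  refine ⟨c, s0, ?_, ?_, ?_, fun i h1 h2 => ?_⟩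
  · simpa [s0] using s1
  · refine v.map_eq_of_map_mul_eq (y := ((x : ℕ) : K) - ((y : ℕ) : K)) ?_ (hD x y hxy)
    rw [mul_comm, hcx, v.map_neg]
    exact map_sum_eq_inf' v hD hα hc₀ hI fun i hi => ((hIE i).1 hi).2
  · refine v.map_eq_of_map_mul_eq (y := ((y : ℕ) : K) - ((x : ℕ) : K)) ?_ (hD y x hyx)
    rw [mul_comm, hcy, v.map_neg]
    exact map_sum_eq_inf' v hD hα hc₀ hJ fun i hi => ((hJE i).1 hi).2
  · rw [hci i h1 h2, hc₀]

/-- For a suitable pair `x`, `y`, the values at `x` and `y` are determined by the others as minima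
in the circuits of `y` and `x`. The continuous map `Φ` recomputes them and fixes the given point. It
remains to approximate the other values by separated points in the value group and to solve for `c
x` and `c y`. -/
theorem circuitLocus_subset_closure_liftedPairs (hdense : Dense (v.valueGroup : Set ℝ))
    (hE : ∀ i j : Fin (n + 1), E i j ↔ ((i : ℕ) : K) ≠ ((j : ℕ) : K))
    (hD : ∀ i j : Fin (n + 1), E i j →
      v (((i : ℕ) : K) - ((j : ℕ) : K)) = ((D i j : ℝ) : WithTop ℝ)) :
    circuitLocus E D ⊆ closure (liftedPairs v n) := by
  classical
  rintro ⟨a, b⟩ hab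
  have hEs : ∀ {i j}, E i j → E j i := fun {i j} h => (hE j i).2 ((hE i j).1 h).symm
  have hDs : ∀ {i j}, E i j → (D i j : ℝ) = D j i := by
    intro i j h
    have h1 := hD i j h
    rw [← neg_sub, v.map_neg, hD j i (hEs h)] at h1
    exact (WithTop.coe_injective h1).symm
  let α : Fin (n + 1) → ℝ := fun i => monomialValue a b i
  -- Minimizing over pairs makes `x` minimal in the circuit of `y` and, by symmetry of `D`, `y`
  -- minimal in the circuit of `x`.
  obtain ⟨⟨x, y⟩, hxy, hmin⟩ : ∃ q : Fin (n + 1) × Fin (n + 1), E q.1 q.2 ∧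
      ∀ q' : Fin (n + 1) × Fin (n + 1), E q'.1 q'.2 →
        α q.1 + α q.2 + D q.1 q.2 ≤ α q'.1 + α q'.2 + D q'.1 q'.2 := by
    obtain ⟨x, -, -, hx, -⟩ := hab 0
    obtain ⟨q, hq, h⟩ := (Finset.univ.filter fun q : Fin (n + 1) × Fin (n + 1) =>
      E q.1 q.2).exists_min_image (fun q => α q.1 + α q.2 + D q.1 q.2) ⟨(x, 0), by simpa using hx⟩
    exact ⟨q, by simpa using hq, fun q' hq' => h q' (by simpa using hq')⟩
  dsimp only at hxy hmin
  have hyx := hEs hxy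
  have attained : ∀ z w, (∀ i, E i w → α z + D z w ≤ α i + D i w) → E z w →
      ∃ hI : (Finset.univ.filter fun i => i ≠ z ∧ E i w).Nonempty,
        (Finset.univ.filter fun i => i ≠ z ∧ E i w).inf' hI (fun i => α i + D i w) - D z w
          = α z := by
    intro z w hz hzw
    obtain ⟨s, t, hst, hs, ht, hm⟩ := hab w
    obtain ⟨m, hmz, hmw, hm⟩ : ∃ m, m ≠ z ∧ E m w ∧ α m + D m w ≤ α z + D z w := by
      by_cases hsz : s = z
      · exact ⟨t, fun e => hst (hsz.trans e.symm), ht, (hm z hzw).2⟩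
      · exact ⟨s, hsz, hs, (hm z hzw).1⟩
    have hmI : m ∈ Finset.univ.filter fun i => i ≠ z ∧ E i w := by simp [hmz, hmw]
    refine ⟨⟨m, hmI⟩, ?_⟩
    rw [sub_eq_iff_eq_add]
    refine le_antisymm ((Finset.inf'_le _ hmI).trans hm) (Finset.le_inf' _ _ fun i hi => ?_)
    exact hz i (Finset.mem_filter.1 hi).2.2
  obtain ⟨hI, eI⟩ := attained x y (fun i hi => by
    have := hmin (i, y) hi
    dsimp only at this
    linarith) hxy
  obtain ⟨hJ, eJ⟩ := attained y x (fun i hi => by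
    have := hmin (i, x) hi
    dsimp only at this
    rw [hDs hxy] at this
    linarith) hyx
  set I := Finset.univ.filter fun i => i ≠ x ∧ E i y
  set J := Finset.univ.filter fun i => i ≠ y ∧ E i x
  let Φ : (Fin (n + 1) → ℝ) → Fin (n + 1) → ℝ := fun β i =>
    if i = x then I.inf' hI (fun i => β i + D i y) - D x y
    else if i = y then J.inf' hJ (fun i => β i + D i x) - D y x else β i
  let Ψ : (Fin (n + 1) → ℝ) × ℝ → (Fin (n + 1) → ℝ) × ℝ := fun q =>
    (fun i => Φ q.1 i - (i : ℕ) * q.2, q.2)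
  have hΦ : Continuous Φ := by
    refine continuous_pi fun i => ?_
    by_cases h1 : i = x
    · simp only [Φ, h1, if_true]
      exact (Continuous.finset_inf'_apply hI fun i _ => by fun_prop).sub continuous_const
    · by_cases h2 : i = y
      · simp only [Φ, h2, if_true]
        have : y ≠ x := fun e => h1 (h2.trans e)
        simp only [this, if_false]
        exact (Continuous.finset_inf'_apply hJ fun i _ => by fun_prop).sub continuous_const
      · simp only [Φ, h1, h2, if_false]
        fun_prop
  have hΨ : Continuous Ψ := by
    refine Continuous.prodMk (continuous_pi fun i => ?_) continuous_snd
    exact ((continuous_apply i).comp (hΦ.comp continuous_fst)).sub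
      (continuous_const.mul continuous_snd)
  have hfix : Ψ (α, b) = (a, b) := by
    have : Φ α = α := by
      ext i
      by_cases h1 : i = x
      · simp only [Φ, h1, if_true]
        exact eI
      · by_cases h2 : i = y
        · have : y ≠ x := fun e => h1 (h2.trans e)
          simp only [Φ, h2, this, if_true, if_false]
          exact eJ
        · simp only [Φ, h1, h2, if_false]
    change (fun i => Φ α i - (i : ℕ) * b, b) = (a, b)
    rw [this]
    simp only [α, monomialValue, add_sub_cancel_right]
  let G : Set (Fin (n + 1) → ℝ) := Set.univ.pi (fun _ => (v.valueGroup : Set ℝ)) ∩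
    separatedPoints D
  have hG : Dense (G ×ˢ (v.valueGroup : Set ℝ)) :=
    ((dense_pi _ fun _ _ => hdense).inter_of_isOpen_right (dense_separatedPoints D)
      (isOpen_separatedPoints D)).prod hdense
  rw [← hfix]
  refine closure_mono ?_ (image_closure_subset_closure_image hΨ ⟨_, hG (α, b), rfl⟩)
  rintro _ ⟨⟨β, b'⟩, ⟨⟨hβ, hsep⟩, B, hB⟩, rfl⟩
  obtain ⟨c, h0, h1, hx, hy, hi⟩ := exists_coefficients v hE hD hsep (fun i => hβ i trivial) hxy
    hyx hI hJ (fun i => by simp [I]) fun i => by simp [J]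
  refine (mem_liftedPairs_iff v n _).2 ⟨c, B, fun i => ?_, hB, h0, h1⟩
  simp only [Ψ, monomialValue, sub_add_cancel]
  by_cases h1 : i = x
  · simp only [Φ, h1, if_true, hx]
  · by_cases h2 : i = y
    · have : y ≠ x := fun e => h1 (h2.trans e)
      simp only [Φ, h2, this, if_true, if_false, hy]
    · simp only [Φ, h1, h2, if_false, hi i h1 h2]

theorem doubleRootPairs_eq_circuitLocus (hdense : Dense (v.valueGroup : Set ℝ))
    (hE : ∀ i j : Fin (n + 1), E i j ↔ ((i : ℕ) : K) ≠ ((j : ℕ) : K))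
    (hD : ∀ i j : Fin (n + 1), E i j →
      v (((i : ℕ) : K) - ((j : ℕ) : K)) = ((D i j : ℝ) : WithTop ℝ)) :
    doubleRootPairs v n = circuitLocus E D :=
  (closure_minimal (liftedPairs_subset_circuitLocus v hE hD) (isClosed_circuitLocus E D)).antisymm
    (circuitLocus_subset_closure_liftedPairs v hdense hE hD)

theorem tropDiscriminant_eq_fst_image (hdense : Dense (v.valueGroup : Set ℝ))
    (hE : ∀ i j : Fin (n + 1), E i j ↔ ((i : ℕ) : K) ≠ ((j : ℕ) : K))
    (hD : ∀ i j : Fin (n + 1), E i j →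
      v (((i : ℕ) : K) - ((j : ℕ) : K)) = ((D i j : ℝ) : WithTop ℝ)) :
    tropDiscriminant v n = Prod.fst '' circuitLocus E D := by
  apply (closure_minimal (Set.image_mono (liftedPairs_subset_circuitLocus v hE hD))
    (isClosed_fst_image_circuitLocus E D)).antisymm
  rw [← doubleRootPairs_eq_circuitLocus v hdense hE hD]
  exact image_closure_subset_closure_image continuous_fst

end lifting

/-! ### The two fields and the theorem -/

theorem intCast_sub_fin {K : Type*} [Field K] {n : ℕ} (i j : Fin (n + 1)) :
    ((((i : ℕ) - (j : ℕ) : ℤ)) : K) = ((i : ℕ) : K) - ((j : ℕ) : K) := by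
  push_cast
  rfl

theorem padicLocus_eq {K : Type*} [Field K] [IsAlgClosed K] [CharZero K] {p : ℕ} (hp : p.Prime)
    (n : ℕ) (v : AddValuation K (WithTop ℝ)) (hv : v (p : K) = ((1 : ℝ) : WithTop ℝ)) :
    doubleRootPairs v n = padicLocus p n ∧
      tropDiscriminant v n = Prod.fst '' padicLocus p n := by
  have hdense := v.dense_valueGroup ⟨p, v.ne_zero_of_eq_coe hv, by
    rw [hv]
    exact fun h => one_ne_zero (WithTop.coe_injective h)⟩
  have hE : ∀ i j : Fin (n + 1), i ≠ j ↔ ((i : ℕ) : K) ≠ ((j : ℕ) : K) := by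
    intro i j
    rw [Ne, Ne, Nat.cast_inj, Fin.ext_iff]
  have hD : ∀ i j : Fin (n + 1), i ≠ j →
      v (((i : ℕ) : K) - ((j : ℕ) : K)) = ((indexVal p i j : ℝ) : WithTop ℝ) := by
    intro i j hij
    rw [← intCast_sub_fin, v.map_intCast_eq_padicValInt hp hv]
    · rfl
    · have := Fin.val_ne_of_ne hij
      omega
  exact ⟨doubleRootPairs_eq_circuitLocus v hdense hE hD,
    tropDiscriminant_eq_fst_image v hdense hE hD⟩

theorem charLocus_eq {k : Type*} [Field k] [IsAlgClosed k] {p : ℕ} [CharP k p] (hp : p.Prime)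
    (n : ℕ) (w : AddValuation k (WithTop ℝ)) (hw : ∃ x : k, x ≠ 0 ∧ w x ≠ 0) :
    doubleRootPairs w n = charLocus p n ∧
      tropDiscriminant w n = Prod.fst '' charLocus p n := by
  have hdense := w.dense_valueGroup hw
  have hE : ∀ i j : Fin (n + 1), ¬ (i : ℕ) ≡ j [MOD p] ↔ ((i : ℕ) : k) ≠ ((j : ℕ) : k) := by
    intro i j
    rw [Ne, CharP.natCast_eq_natCast k p]
  have hD : ∀ i j : Fin (n + 1), ¬ (i : ℕ) ≡ j [MOD p] →
      w (((i : ℕ) : k) - ((j : ℕ) : k)) = ((indexVal p i j : ℝ) : WithTop ℝ) := by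
    intro i j hij
    rw [← intCast_sub_fin, w.map_intCast_eq_zero hp, indexVal_eq_zero hij]
    · simp
    · rw [CharP.cast_eq_zero, w.map_zero]
      exact WithTop.coe_lt_top 0
    · rwa [intCast_dvd_sub_iff]
  exact ⟨doubleRootPairs_eq_circuitLocus w hdense hE hD,
    tropDiscriminant_eq_fst_image w hdense hE hD⟩

theorem mainTheorem11 (p n : ℕ) (hp : p.Prime) :
    ∃ ε₀ : ℝ, 0 < ε₀ ∧ ∃ M₀ : ℝ, 0 < M₀ ∧
      ∀ (K : Type*) [Field K] [IsAlgClosed K] [CharZero K]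
        (v : AddValuation K (WithTop ℝ)) (_hv : v (p : K) = ((1 : ℝ) : WithTop ℝ))
        (k : Type*) [Field k] [IsAlgClosed k] [CharP k p]
        (w : AddValuation k (WithTop ℝ)) (_hw : ∃ x : k, x ≠ 0 ∧ w x ≠ 0),
        (∀ ε : ℝ, 0 < ε → ε ≤ ε₀ →
          tropDiscriminant v n ∩ Metric.ball 0 ε = tropDiscriminant w n ∩ Metric.ball 0 ε) ∧
        (∀ M : ℝ, M₀ ≤ M →
          ∀ S : Set ((Fin (n + 1) → ℝ) × ℝ),
            (S = doubleRootPairs v n ∨ S = doubleRootPairs w n) →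
            {C : Set (Fin (n + 1) → ℝ) |
              IsMaximalCell (tropDiscriminant v n) C ∧ IsMaximalCell (tropDiscriminant w n) C ∧
              ∃ P, IsTopCell P ∧ P ⊆ C ∩ gapRegion S M} = typeICones p n ∧
            ∀ P : Set (Fin (n + 1) → ℝ), IsTopCell P →
              P ⊆ tropDiscriminant v n ∩ tropDiscriminant w n ∩ gapRegion S M →
              ∃ C ∈ typeICones p n, P ⊆ C) := by

  -- With `|a i| < ε` and `|b| ≤ ε`, monomial values are below `(n + 1) * ε ≤ 1 / 2` in absolute
  -- value. The gap must exceed the bound `n + n * n` from `exists_triple_of_char_gap`.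
  refine ⟨1 / (2 * (n + 1)), by positivity, n + n * n + 1, by positivity, ?_⟩
  intro K _ _ _ v hv k _ _ _ w hw
  obtain ⟨hv1, hv2⟩ := padicLocus_eq hp n v hv
  obtain ⟨hw1, hw2⟩ := charLocus_eq hp n w hw
  rw [hv1, hv2, hw1, hw2]
  refine ⟨fun ε hε hs => padicLocus_inter_ball_eq hp hε hs, fun M hM S hS => ?_⟩
  have hM' : (n : ℝ) + n * n < M := by linarith
  refine ⟨setOf_isMaximalCell_eq_typeICones hp hM' hS, fun P hP hsub => ?_⟩
  obtain ⟨i, j, k, hij, hik, hjk, h⟩ := exists_tripleCone_superset hp hP hM' hS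
    (fun a ha => (hsub ha).1.1) (fun a ha => (hsub ha).1.2) fun a ha => (hsub ha).2
  exact ⟨_, ⟨i, j, k, hij, hik, hjk, rfl⟩, h⟩
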